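/- Consider the Euler–Darboux equation $\mathcal E_{ED}=\{F=0\}$, $F=(x+y)(u_{xx}+u_{yy})+u_x+u_y$, for a function $u=u(x,y)$ on $\mathbb R^2$. Let $u_{hx,ky}$ ($h,k\ge 0$) be the jet variables on the infinite jet space $J^\infty$ of the trivial bundle $\mathbb R^2\times\mathbb R\to\mathbb R^2$, let $\mathcal R(J^\infty)$ be the field of real rational functions of finitely many of the coordinates $x,y,u_{hx,ky}$, let $$D_x=\partial_x+\sum_{h,k}u_{(h+1)x,ky}\,\partial_{u_{hx,ky}},\qquad D_y=\partial_y+\sum_{h,k}u_{hx,(k+1)y}\,\partial_{u_{hx,ky}}$$ be the total derivatives, and let $\mathcal E^\infty=\{D_x^aD_y^b(F)=0,\ a,b\ge 0\}$ be the infinite prolongation of $\mathcal E_{ED}$, with internal coordinates $x,y,u_{ky},u_{x,ky}$ ($k\ge 0$) where $x+y\neq 0$; a bar denotes restriction to $\mathcal E^\infty$. A rational higher symmetry of $\mathcal E_{ED}$ is the restriction $\bar\varphi$ to $\mathcal E^\infty$ of a function $\varphi\in\mathcal R(J^\infty)$, whose denominator does not vanish identically on $\mathcal E^\infty$, such that the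 evolutionary vector field $X_\varphi=\sum_{h,k}D_x^hD_y^k(\varphi)\,\partial_{u_{hx,ky}}$ is tangent to $\mathcal E^\infty$. Let $\operatorname{NSym}(\mathcal E_{ED})$ be the real vector space of rational higher symmetries modulo the rational solutions $s(x,y)$ of $\mathcal E_{ED}$. On $\mathcal R(J^\infty)$ consider the operators $$\widetilde\square=-D_x+D_y,\qquad \widetilde\sigma=xD_x+yD_y+\tfrac12,$$ $$\widetilde\tau=\left(\tfrac12x^2-xy-\tfrac12y^2\right)D_x+\left(\tfrac12x^2+xy-\tfrac12y^2\right)D_y+\tfrac12(x-y),$$ and, for integers $m,j\ge 0$, the $j$-fold iterated commutator $\nabla^m_j=[\dots[\widetilde\square^m,\widetilde\tau],\dots,\widetilde\tau]$. These operators restrict to $\mathcal E^\infty$; let $\overline\nabla{}^m_j$ be the restriction of $\nabla^m_j$. Theorem. As a real vector space, $\operatorname{NSym}(\mathcal E_{ED})$ is spanned by the classes of $u$ and of $\overline\nabla{}^m_j(u)$, $m,j\ge 0$. Moreover, for all integers $m\ge 0$, $$[\nabla^m_j,\widetilde\square]=j(2m-j+1)\,\nabla^m_{j-1}\quad(1\le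 j\le 2m),$$ $$[\nabla^m_j,\widetilde\sigma]=(m-j)\,\nabla^m_j\quad(0\le j\le 2m),$$ $$[\nabla^m_j,\widetilde\tau]=\nabla^m_{j+1}\quad(0\le j\le 2m),$$ and $\overline\nabla{}^m_j(u)\neq 0$, both as a function on $\mathcal E^\infty$ and as an element of $\operatorname{NSym}(\mathcal E_{ED})$, for $0\le j\le 2m$, while $\overline\nabla{}^m_j(u)=0$ for $j\ge 2m+1$. -/

import Mathlib

open MvPolynomial

noncomputable section

namespace EulerDarboux

/-! ### Fields of rational functions and their derivations -/

/-- Real rational functions in the variables `v`, each involving finitely many of them. -/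
abbrev RatFun (v : Type) : Type := FractionRing (MvPolynomial v ℝ)

/-- A variable, as a rational function. -/
def coord {v : Type} (i : v) : RatFun v := algebraMap (MvPolynomial v ℝ) (RatFun v) (X i)

/-- The homomorphism `p ↦ p + ε D p` to the dual numbers, where `D` is the derivation of polynomials
with values in rational functions which takes the value `a i` on the variable `i`. -/
def dualHom {v : Type} (a : v → RatFun v) :
    MvPolynomial v ℝ →+* TrivSqZeroExt (RatFun v) (RatFun v) where
  toFun p := TrivSqZeroExt.inl (algebraMap (MvPolynomial v ℝ) (RatFun v) p) +
    TrivSqZeroExt.inr (mkDerivation ℝ a p)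
  map_one' := by simp
  map_zero' := by simp
  map_add' p q := by ext <;> simp
  map_mul' p q := by
    ext
    · simp
    · simp only [Derivation.leibniz, Algebra.smul_def, map_mul, TrivSqZeroExt.snd_add,
        TrivSqZeroExt.snd_mul, TrivSqZeroExt.fst_add, TrivSqZeroExt.fst_inl, TrivSqZeroExt.fst_inr,
        TrivSqZeroExt.snd_inl, TrivSqZeroExt.snd_inr, MulOpposite.smul_eq_mul_unop,
        MulOpposite.unop_op, zero_add, add_zero, Algebra.algebraMap_self_apply]
      ring

theorem fst_dualHom {v : Type} (a : v → RatFun v) (p : MvPolynomial v ℝ) :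
    (dualHom a p).fst = algebraMap _ (RatFun v) p := by simp [dualHom]

theorem snd_dualHom {v : Type} (a : v → RatFun v) (p : MvPolynomial v ℝ) :
    (dualHom a p).snd = mkDerivation ℝ a p := by simp [dualHom]

theorem isUnit_dualHom {v : Type} (a : v → RatFun v) (q : nonZeroDivisors (MvPolynomial v ℝ)) :
    IsUnit (dualHom a q) := by
  rw [TrivSqZeroExt.isUnit_iff_isUnit_fst, fst_dualHom]
  exact IsLocalization.map_units (RatFun v) q

/-- The extension of `dualHom` to rational functions. -/
def dualLift {v : Type} (a : v → RatFun v) : RatFun v →+* TrivSqZeroExt (RatFun v) (RatFun v) :=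
  IsLocalization.lift (M := nonZeroDivisors (MvPolynomial v ℝ)) (isUnit_dualHom a)

theorem dualLift_algebraMap {v : Type} (a : v → RatFun v) (p : MvPolynomial v ℝ) :
    dualLift a (algebraMap _ (RatFun v) p) = dualHom a p :=
  IsLocalization.lift_eq _ _

theorem fst_dualLift {v : Type} (a : v → RatFun v) (f : RatFun v) : (dualLift a f).fst = f := by
  have h : ((TrivSqZeroExt.fstHom (RatFun v) (RatFun v) (RatFun v)).toRingHom.comp (dualLift a)) =
      RingHom.id (RatFun v) := by
    apply IsLocalization.ringHom_ext (nonZeroDivisors (MvPolynomial v ℝ))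
    ext p <;> simp [dualLift_algebraMap, fst_dualHom]
  exact congrArg (fun g => g f) h

/-- The derivation `∑ i, a i ∂/∂i` of the field of rational functions, that is, the one which takes
the value `a i` on the variable `i` (see `fracDer_coord`). -/
def fracDer {v : Type} (a : v → RatFun v) : Derivation ℝ (RatFun v) (RatFun v) where
  toFun f := (dualLift a f).snd
  map_add' f g := by simp
  map_smul' r f := by
    have hr : algebraMap ℝ (RatFun v) r = algebraMap (MvPolynomial v ℝ) (RatFun v) (C r) := by
      rw [IsScalarTower.algebraMap_apply ℝ (MvPolynomial v ℝ) (RatFun v)]; rfl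
    rw [Algebra.smul_def, map_mul, TrivSqZeroExt.snd_mul, hr, dualLift_algebraMap, snd_dualHom,
      fst_dualHom, ← hr]
    simp [Algebra.smul_def]
  map_one_eq_zero' := by simp
  leibniz' f g := by
    change (dualLift a (f * g)).snd = f • (dualLift a g).snd + g • (dualLift a f).snd
    simp only [map_mul, TrivSqZeroExt.snd_mul, fst_dualLift, smul_eq_mul,
      MulOpposite.smul_eq_mul_unop, MulOpposite.unop_op]
    ring

theorem fracDer_algebraMap {v : Type} (a : v → RatFun v) (p : MvPolynomial v ℝ) :
    fracDer a (algebraMap _ (RatFun v) p) = mkDerivation ℝ a p := by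
  change (dualLift a _).snd = _
  rw [dualLift_algebraMap, snd_dualHom]

theorem fracDer_coord {v : Type} (a : v → RatFun v) (i : v) : fracDer a (coord i) = a i := by
  rw [coord, fracDer_algebraMap, mkDerivation_X]

/-! ### The infinite jet space `J^∞` of the trivial bundle `ℝ² × ℝ → ℝ²` -/

/-- Coordinates on `J^∞`: `inl 0` is `x`, `inl 1` is `y`, and `inr (h, k)` is the jet variable
`u_{hx,ky}`, the derivative of `u` taken `h` times in `x` and `k` times in `y`. -/
abbrev JetVar : Type := Fin 2 ⊕ (ℕ × ℕ)

/-- Real rational functions on `J^∞`. -/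
abbrev JetFun : Type := RatFun JetVar

/-- The total derivative `D_x = ∂/∂x + ∑ u_{(h+1)x,ky} ∂/∂u_{hx,ky}`. -/
def Dx : Derivation ℝ JetFun JetFun :=
  fracDer (Sum.elim ![1, 0] fun s => coord (Sum.inr (s.1 + 1, s.2)))

/-- The total derivative `D_y = ∂/∂y + ∑ u_{hx,(k+1)y} ∂/∂u_{hx,ky}`. -/
def Dy : Derivation ℝ JetFun JetFun :=
  fracDer (Sum.elim ![0, 1] fun s => coord (Sum.inr (s.1, s.2 + 1)))

/-- The evolutionary vector field `X_φ = ∑ D_x^h D_y^k(φ) ∂/∂u_{hx,ky}` with generating function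
`φ`. -/
def evolutionary (φ : JetFun) : Derivation ℝ JetFun JetFun :=
  fracDer (Sum.elim (fun _ => 0) fun s => Dx^[s.1] (Dy^[s.2] φ))

/-- The left-hand side `F = (x + y)(u_xx + u_yy) + u_x + u_y` of the Euler-Darboux equation. -/
def edPoly : MvPolynomial JetVar ℝ :=
  (X (Sum.inl 0) + X (Sum.inl 1)) * (X (Sum.inr (2, 0)) + X (Sum.inr (0, 2))) +
    X (Sum.inr (1, 0)) + X (Sum.inr (0, 1))

/-! ### The infinite prolongation `𝓔^∞` of the Euler-Darboux equation -/

/-- Internal coordinates on `𝓔^∞`: `inl 0` is `x`, `inl 1` is `y`, `inr (0, k)` is `u_{ky}` and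
`inr (1, k)` is `u_{x,ky}`. -/
abbrev IntVar : Type := Fin 2 ⊕ (Fin 2 × ℕ)

/-- Real rational functions on `𝓔^∞`. -/
abbrev EqFun : Type := RatFun IntVar

/-- The function `u` on `𝓔^∞`. -/
def uE : EqFun := coord (Sum.inr (0, 0))

/-- The restriction of `D_y` to `𝓔^∞`. -/
def DyE : Derivation ℝ EqFun EqFun :=
  fracDer (Sum.elim ![0, 1] fun s => coord (Sum.inr (s.1, s.2 + 1)))

/-- The restriction of `u_xx` to `𝓔^∞`, namely `-u_yy - (u_x + u_y) / (x + y)`. -/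
def uxxE : EqFun :=
  -coord (Sum.inr (0, 2)) -
    (coord (Sum.inr (1, 0)) + coord (Sum.inr (0, 1))) / (coord (Sum.inl 0) + coord (Sum.inl 1))

/-- The restriction of `D_x` to `𝓔^∞`: it maps `u_{ky}` to `u_{x,ky}`, and `u_{x,ky}` to the
restriction of `u_{xx,ky}`. -/
def DxE : Derivation ℝ EqFun EqFun :=
  fracDer (Sum.elim ![1, 0] fun s =>
    if s.1 = 0 then coord (Sum.inr (1, s.2)) else DyE^[s.2] uxxE)

/-- Restriction to `𝓔^∞` of functions which depend polynomially on the jet coordinates. -/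
def restrictPoly : MvPolynomial JetVar ℝ →ₐ[ℝ] EqFun :=
  aeval (Sum.elim (fun i => coord (Sum.inl i)) fun s => DxE^[s.1] (DyE^[s.2] uE))

/-- The rational function `f` on `J^∞` is defined on `𝓔^∞` (it has a denominator which does not
vanish identically there), and its restriction to `𝓔^∞` is `g`. -/
def RestrictsTo (f : JetFun) (g : EqFun) : Prop :=
  ∃ p q : MvPolynomial JetVar ℝ, restrictPoly q ≠ 0 ∧
    f = algebraMap _ JetFun p / algebraMap _ JetFun q ∧ g = restrictPoly p / restrictPoly q

theorem ne_zero_of_restrictPoly {q : MvPolynomial JetVar ℝ} (h : restrictPoly q ≠ 0) :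
    algebraMap _ JetFun q ≠ 0 := by
  intro hq
  rw [FaithfulSMul.algebraMap_eq_zero_iff] at hq
  exact h (by rw [hq, map_zero])

theorem RestrictsTo.add {f₁ f₂ : JetFun} {g₁ g₂ : EqFun} (h₁ : RestrictsTo f₁ g₁)
    (h₂ : RestrictsTo f₂ g₂) : RestrictsTo (f₁ + f₂) (g₁ + g₂) := by
  obtain ⟨p₁, q₁, hq₁, rfl, rfl⟩ := h₁
  obtain ⟨p₂, q₂, hq₂, rfl, rfl⟩ := h₂
  refine ⟨p₁ * q₂ + q₁ * p₂, q₁ * q₂, ?_, ?_, ?_⟩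
  · rw [map_mul]; exact mul_ne_zero hq₁ hq₂
  · rw [div_add_div _ _ (ne_zero_of_restrictPoly hq₁) (ne_zero_of_restrictPoly hq₂)]
    simp only [map_add, map_mul]
  · rw [div_add_div _ _ hq₁ hq₂]
    simp only [map_add, map_mul]

theorem RestrictsTo.mul {f₁ f₂ : JetFun} {g₁ g₂ : EqFun} (h₁ : RestrictsTo f₁ g₁)
    (h₂ : RestrictsTo f₂ g₂) : RestrictsTo (f₁ * f₂) (g₁ * g₂) := by
  obtain ⟨p₁, q₁, hq₁, rfl, rfl⟩ := h₁
  obtain ⟨p₂, q₂, hq₂, rfl, rfl⟩ := h₂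
  refine ⟨p₁ * p₂, q₁ * q₂, ?_, ?_, ?_⟩
  · rw [map_mul]; exact mul_ne_zero hq₁ hq₂
  · rw [div_mul_div_comm]; simp only [map_mul]
  · rw [div_mul_div_comm]; simp only [map_mul]

theorem restrictsTo_poly (p : MvPolynomial JetVar ℝ) :
    RestrictsTo (algebraMap _ JetFun p) (restrictPoly p) :=
  ⟨p, 1, by simp, by simp, by simp⟩

theorem restrictsTo_const (c : ℝ) : RestrictsTo (algebraMap ℝ JetFun c) (algebraMap ℝ EqFun c) := by
  have h := restrictsTo_poly (C c)
  rwa [← MvPolynomial.algebraMap_eq, AlgHom.commutes,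
    ← IsScalarTower.algebraMap_apply ℝ (MvPolynomial JetVar ℝ) JetFun] at h

theorem RestrictsTo.smul {f : JetFun} {g : EqFun} (c : ℝ) (h : RestrictsTo f g) :
    RestrictsTo (c • f) (c • g) := by
  rw [Algebra.smul_def, Algebra.smul_def]
  exact (restrictsTo_const c).mul h

theorem restrictsTo_zero : RestrictsTo 0 0 := by
  simpa using restrictsTo_poly 0

/-! ### Symmetries, solutions, and the quotient -/

/-- The evolutionary field `X_φ` is tangent to `𝓔^∞ = {D_x^a D_y^b(F) = 0 for all a, b}`. -/
def IsTangent (φ : JetFun) : Prop :=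
  ∀ a b : ℕ, RestrictsTo (evolutionary φ (Dx^[a] (Dy^[b] (algebraMap _ JetFun edPoly)))) 0

theorem iterate_smul (D : Derivation ℝ JetFun JetFun) (n : ℕ) (c : ℝ) (f : JetFun) :
    D^[n] (c • f) = c • D^[n] f := by
  induction n generalizing f with
  | zero => rfl
  | succ n ih => rw [Function.iterate_succ_apply, Derivation.map_smul, ih, Function.iterate_succ_apply]

theorem fracDer_ext {v : Type} {D₁ D₂ : Derivation ℝ (RatFun v) (RatFun v)}
    (h : ∀ i, D₁ (coord i) = D₂ (coord i)) : D₁ = D₂ := by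
  have hp : ∀ p : MvPolynomial v ℝ, D₁ (algebraMap _ _ p) = D₂ (algebraMap _ _ p) := by
    intro p
    have := MvPolynomial.derivation_ext (D₁ := D₁.compAlgebraMap (MvPolynomial v ℝ))
      (D₂ := D₂.compAlgebraMap (MvPolynomial v ℝ)) h
    exact congrArg (fun D => D p) this
  ext f
  obtain ⟨p, q, -, rfl⟩ := IsFractionRing.div_surjective (A := MvPolynomial v ℝ) f
  rw [Derivation.leibniz_div, Derivation.leibniz_div, hp, hp]

theorem evolutionary_add (φ ψ : JetFun) :
    evolutionary (φ + ψ) = evolutionary φ + evolutionary ψ := by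
  apply fracDer_ext
  rintro (i | s) <;> simp [evolutionary, fracDer_coord]

theorem evolutionary_smul (c : ℝ) (φ : JetFun) : evolutionary (c • φ) = c • evolutionary φ := by
  apply fracDer_ext
  rintro (i | s) <;> simp [evolutionary, fracDer_coord, iterate_smul]

/-- The rational higher symmetries of the Euler-Darboux equation, as functions on `𝓔^∞`: the
restrictions to `𝓔^∞` of the generating functions of evolutionary fields tangent to `𝓔^∞`. -/
def HigherSym : Submodule ℝ EqFun where
  carrier := {g | ∃ φ : JetFun, RestrictsTo φ g ∧ IsTangent φ}
  zero_mem' := ⟨0, restrictsTo_zero, fun a b => by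
    have h : evolutionary 0 = 0 := by simpa using evolutionary_smul 0 0
    rw [h]
    exact restrictsTo_zero⟩
  add_mem' := by
    rintro g₁ g₂ ⟨φ₁, h₁, t₁⟩ ⟨φ₂, h₂, t₂⟩
    refine ⟨φ₁ + φ₂, h₁.add h₂, fun a b => ?_⟩
    rw [evolutionary_add]
    simpa using (t₁ a b).add (t₂ a b)
  smul_mem' := by
    rintro c g ⟨φ, h, t⟩
    refine ⟨c • φ, h.smul c, fun a b => ?_⟩
    rw [evolutionary_smul]
    simpa using (t a b).smul c

/-- The partial derivative `∂/∂x` of rational functions of `(x, y)`. -/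
def pdx : Derivation ℝ (RatFun (Fin 2)) (RatFun (Fin 2)) := fracDer ![1, 0]

/-- The partial derivative `∂/∂y` of rational functions of `(x, y)`. -/
def pdy : Derivation ℝ (RatFun (Fin 2)) (RatFun (Fin 2)) := fracDer ![0, 1]

/-- The value of a polynomial function of the jet coordinates on the infinite jet of `s(x, y)`. -/
def evalOnJet (s : RatFun (Fin 2)) : MvPolynomial JetVar ℝ →ₐ[ℝ] RatFun (Fin 2) :=
  aeval (Sum.elim coord fun k => pdx^[k.1] (pdy^[k.2] s))

/-- The rational solutions `s(x, y)` of the Euler-Darboux equation. -/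
def ratSolutions : Submodule ℝ (RatFun (Fin 2)) where
  carrier := {s | evalOnJet s edPoly = 0}
  zero_mem' := by simp [evalOnJet, edPoly]
  add_mem' := by
    intro s t hs ht
    simp only [Set.mem_ofPred_eq, evalOnJet, edPoly, map_add, map_mul, aeval_X, Sum.elim_inl,
      Sum.elim_inr, Function.iterate_succ, Function.iterate_zero, Function.comp_apply, id_eq]
      at hs ht ⊢
    linear_combination hs + ht
  smul_mem' := by
    intro c s hs
    simp only [Set.mem_ofPred_eq, evalOnJet, edPoly, map_add, map_mul, aeval_X, Sum.elim_inl,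
      Sum.elim_inr, Function.iterate_succ, Function.iterate_zero, Function.comp_apply, id_eq,
      Derivation.map_smul] at hs ⊢
    simp only [Algebra.smul_def]
    linear_combination (algebraMap ℝ (RatFun (Fin 2)) c) * hs

theorem baseHom_injective : Function.Injective
    ((algebraMap (MvPolynomial IntVar ℝ) EqFun).comp
      (rename (R := ℝ) (Sum.inl : Fin 2 → IntVar)).toRingHom) :=
  (IsFractionRing.injective (MvPolynomial IntVar ℝ) EqFun).comp
    (rename_injective _ Sum.inl_injective)

/-- Rational functions of `(x, y)`, as functions on `𝓔^∞`. -/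
def baseIncl : RatFun (Fin 2) →ₐ[ℝ] EqFun :=
  IsFractionRing.liftAlgHom
    (g := (Algebra.algHom ℝ (MvPolynomial IntVar ℝ) EqFun).comp (rename Sum.inl)) baseHom_injective

/-- The rational solutions of the Euler-Darboux equation, as functions on `𝓔^∞`. -/
def Sol : Submodule ℝ EqFun := ratSolutions.map baseIncl.toLinearMap

/-- Rational higher symmetries modulo solutions: the image of `HigherSym` in the space of rational
functions on `𝓔^∞` modulo solutions. -/
def NSym : Submodule ℝ (EqFun ⧸ Sol) := HigherSym.map Sol.mkQ

/-! ### The recursion operators -/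

section Operators

variable {A : Type} [Field A] [Algebra ℝ A]

/-- `-D₁ + D₂`. -/
def boxOp (D₁ D₂ : Derivation ℝ A A) : Module.End ℝ A :=
  -(D₁ : A →ₗ[ℝ] A) + (D₂ : A →ₗ[ℝ] A)

/-- `(x²/2 - xy - y²/2) D₁ + (x²/2 + xy - y²/2) D₂ + (x - y)/2`. -/
def tauOp (x y : A) (D₁ D₂ : Derivation ℝ A A) : Module.End ℝ A :=
  (x ^ 2 / 2 - x * y - y ^ 2 / 2) • (D₁ : A →ₗ[ℝ] A) +
    (x ^ 2 / 2 + x * y - y ^ 2 / 2) • (D₂ : A →ₗ[ℝ] A) + ((x - y) / 2) • LinearMap.id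

/-- `x D₁ + y D₂ + 1/2`. -/
def sigmaOp (x y : A) (D₁ D₂ : Derivation ℝ A A) : Module.End ℝ A :=
  x • (D₁ : A →ₗ[ℝ] A) + y • (D₂ : A →ₗ[ℝ] A) + (1 / 2 : A) • LinearMap.id

/-- The `j`-fold iterated commutator `[…[B, T], …, T]`. -/
def iterComm (B T : Module.End ℝ A) : ℕ → Module.End ℝ A
  | 0 => B
  | j + 1 => ⁅iterComm B T j, T⁆

end Operators

/-- The operator `-D_x + D_y` on rational functions on `J^∞`. -/
def box : Module.End ℝ JetFun := boxOp Dx Dy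

/-- The operator `(x²/2 - xy - y²/2) D_x + (x²/2 + xy - y²/2) D_y + (x - y)/2` on rational functions
on `J^∞`. -/
def tau : Module.End ℝ JetFun := tauOp (coord (Sum.inl 0)) (coord (Sum.inl 1)) Dx Dy

/-- The operator `x D_x + y D_y + 1/2` on rational functions on `J^∞`. -/
def sigma : Module.End ℝ JetFun := sigmaOp (coord (Sum.inl 0)) (coord (Sum.inl 1)) Dx Dy

/-- The operator `∇_j^m = […[box^m, tau], …, tau]` (`j` commutators) on rational functions
on `J^∞`. -/
def nabla (m j : ℕ) : Module.End ℝ JetFun := iterComm (box ^ m) tau j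

/-- The restriction of `∇_j^m` to `𝓔^∞`, obtained by restricting the total derivatives
(see `nabla_restrictsTo`). -/
def nablaE (m j : ℕ) : Module.End ℝ EqFun :=
  iterComm (boxOp DxE DyE ^ m) (tauOp (coord (Sum.inl 0)) (coord (Sum.inl 1)) DxE DyE) j

theorem DxE_DyE (f : EqFun) : DxE (DyE f) = DyE (DxE f) := by
  have h : ⁅DxE, DyE⁆ = 0 := by
    apply fracDer_ext
    rintro (i | ⟨i, k⟩)
    · fin_cases i <;> simp [Derivation.commutator_apply, DxE, DyE, fracDer_coord]
    · fin_cases i <;>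
        simp [Derivation.commutator_apply, DxE, DyE, fracDer_coord, Function.iterate_succ_apply']
  have := congrArg (fun D => D f) h
  simpa [Derivation.commutator_apply, sub_eq_zero] using this

theorem DyE_iterate_DxE (n : ℕ) (f : EqFun) : DyE (DxE^[n] f) = DxE^[n] (DyE f) := by
  induction n with
  | zero => rfl
  | succ n ih => rw [Function.iterate_succ_apply', ← DxE_DyE, ih, Function.iterate_succ_apply']

/-- The operator `Q` on functions on `𝓔^∞` is the restriction of the operator `P`. -/
def OpRestrictsTo (P : JetFun → JetFun) (Q : EqFun → EqFun) : Prop :=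
  ∀ f g, RestrictsTo f g → RestrictsTo (P f) (Q g)

theorem restrictsTo_coord (i : JetVar) :
    RestrictsTo (coord i)
      (Sum.elim (fun i => coord (Sum.inl i)) (fun s => DxE^[s.1] (DyE^[s.2] uE)) i) := by
  simpa [restrictPoly, coord] using restrictsTo_poly (X i)

theorem opRestrictsTo_derivation (D : Derivation ℝ JetFun JetFun) (E : Derivation ℝ EqFun EqFun)
    (h : ∀ i, RestrictsTo (D (coord i)) (E (restrictPoly (X i)))) : OpRestrictsTo D E := by
  have hp : ∀ p : MvPolynomial JetVar ℝ,
      RestrictsTo (D (algebraMap _ JetFun p)) (E (restrictPoly p)) := by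
    intro p
    induction p using MvPolynomial.induction_on with
    | C c =>
      rw [← MvPolynomial.algebraMap_eq, AlgHom.commutes,
        ← IsScalarTower.algebraMap_apply ℝ (MvPolynomial JetVar ℝ) JetFun,
        Derivation.map_algebraMap, Derivation.map_algebraMap]
      exact restrictsTo_zero
    | add p q ihp ihq => simpa using ihp.add ihq
    | mul_X p i ih =>
      simp only [map_mul, Derivation.leibniz, smul_eq_mul]
      exact ((restrictsTo_poly p).mul (h i)).add ((restrictsTo_poly (X i)).mul ih)
  rintro f g ⟨p, q, hq, rfl, rfl⟩
  have hinv : RestrictsTo ((algebraMap _ JetFun q ^ 2)⁻¹) ((restrictPoly q ^ 2)⁻¹) :=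
    ⟨1, q ^ 2, by simpa using hq, by simp, by simp⟩
  rw [Derivation.leibniz_div, Derivation.leibniz_div]
  have := hinv.mul (((restrictsTo_poly q).mul (hp p)).add
    (((restrictsTo_poly p).mul (hp q)).smul (-1)))
  simpa [sub_eq_add_neg] using this

theorem opRestrictsTo_Dx : OpRestrictsTo Dx DxE := by
  apply opRestrictsTo_derivation
  rintro (i | s)
  · fin_cases i
    · simpa [restrictPoly, Dx, DxE, fracDer_coord] using restrictsTo_poly 1
    · simpa [restrictPoly, Dx, DxE, fracDer_coord] using restrictsTo_zero
  · have := restrictsTo_coord (Sum.inr (s.1 + 1, s.2))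
    simpa [restrictPoly, Dx, fracDer_coord, Function.iterate_succ_apply'] using this

theorem opRestrictsTo_Dy : OpRestrictsTo Dy DyE := by
  apply opRestrictsTo_derivation
  rintro (i | s)
  · fin_cases i
    · simpa [restrictPoly, Dy, DyE, fracDer_coord] using restrictsTo_zero
    · simpa [restrictPoly, Dy, DyE, fracDer_coord] using restrictsTo_poly 1
  · have := restrictsTo_coord (Sum.inr (s.1, s.2 + 1))
    simp only [Sum.elim_inr, Function.iterate_succ_apply', ← DyE_iterate_DxE] at this
    simpa [restrictPoly, Dy, fracDer_coord] using this

/-- The restriction of `∇_j^m f` to `𝓔^∞` is `nablaE m j` applied to the restriction of `f`. -/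
theorem nabla_restrictsTo (m j : ℕ) : OpRestrictsTo (nabla m j) (nablaE m j) := by
  have hx : RestrictsTo (coord (Sum.inl 0)) (coord (Sum.inl 0)) := restrictsTo_coord (Sum.inl 0)
  have hy : RestrictsTo (coord (Sum.inl 1)) (coord (Sum.inl 1)) := restrictsTo_coord (Sum.inl 1)
  have hb : OpRestrictsTo box (boxOp DxE DyE) := fun f g h => by
    simpa [box, boxOp] using ((opRestrictsTo_Dx f g h).smul (-1)).add (opRestrictsTo_Dy f g h)
  have ht : OpRestrictsTo tau (tauOp (coord (Sum.inl 0)) (coord (Sum.inl 1)) DxE DyE) := by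
    intro f g h
    have h2 : RestrictsTo (2⁻¹ : JetFun) (2⁻¹ : EqFun) := by
      have := restrictsTo_const 2⁻¹
      rwa [map_inv₀, map_inv₀, map_ofNat, map_ofNat] at this
    have hxx := (hx.mul hx).mul h2
    have hxy := hx.mul hy
    have hyy := ((hy.mul hy).mul h2).smul (-1)
    have := ((((hxx.add (hxy.smul (-1))).add hyy).mul (opRestrictsTo_Dx f g h)).add
      (((hxx.add hxy).add hyy).mul (opRestrictsTo_Dy f g h))).add
      (((hx.add (hy.smul (-1))).mul h2).mul h)
    simpa [tau, tauOp, sub_eq_add_neg, div_eq_mul_inv, sq] using this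
  have hm : OpRestrictsTo ⇑(box ^ m) ⇑(boxOp DxE DyE ^ m) := by
    induction m with
    | zero => exact fun f g h => h
    | succ m ih =>
      intro f g h
      rw [pow_succ, pow_succ]
      exact ih _ _ (hb _ _ h)
  induction j with
  | zero => exact hm
  | succ j ih =>
    intro f g h
    have := (ih _ _ (ht _ _ h)).add ((ht _ _ (ih _ _ h)).smul (-1))
    simpa [nabla, nablaE, iterComm, Ring.lie_def, sub_eq_add_neg] using this

end EulerDarboux

end

open EulerDarboux

noncomputable section

namespace EulerDarboux

section Ladder

open scoped Polynomial

variable {M : Type*} [AddCommGroup M] [Module ℂ M]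

/-- The polynomial with simple roots at the integers in `s`. -/
def rootPoly (s : Finset ℤ) : ℂ[X] := ∏ i ∈ s, (Polynomial.X - Polynomial.C (i : ℂ))

/-- The kernel of `rootPoly s` evaluated at `θ`. -/
def eigenKer (θ : Module.End ℂ M) (s : Finset ℤ) : Submodule ℂ M :=
  LinearMap.ker (Polynomial.aeval θ (rootPoly s))

theorem mem_eigenKer {θ : Module.End ℂ M} {s : Finset ℤ} {f : M} :
    f ∈ eigenKer θ s ↔ Polynomial.aeval θ (rootPoly s) f = 0 := LinearMap.mem_ker

theorem aeval_comm_apply (θ : Module.End ℂ M) (p q : ℂ[X]) (f : M) :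
    Polynomial.aeval θ p (Polynomial.aeval θ q f) =
      Polynomial.aeval θ q (Polynomial.aeval θ p f) := by
  rw [← Module.End.mul_apply, ← Module.End.mul_apply, ← map_mul, ← map_mul, mul_comm]

theorem aeval_apply_comm (θ : Module.End ℂ M) (p : ℂ[X]) (f : M) :
    Polynomial.aeval θ p (θ f) = θ (Polynomial.aeval θ p f) := by
  simpa using aeval_comm_apply θ p Polynomial.X f

theorem eigenKer_mono (θ : Module.End ℂ M) {s t : Finset ℤ} (h : s ⊆ t) :
    eigenKer θ s ≤ eigenKer θ t := by
  intro f hf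
  rw [mem_eigenKer] at hf ⊢
  rw [rootPoly, ← Finset.prod_sdiff h, map_mul, Module.End.mul_apply]
  rw [rootPoly] at hf
  rw [hf, map_zero]

theorem theta_mem_eigenKer {θ : Module.End ℂ M} {s : Finset ℤ} {f : M} (hf : f ∈ eigenKer θ s) :
    θ f ∈ eigenKer θ s := by
  rw [mem_eigenKer] at hf ⊢
  rw [aeval_apply_comm, hf, map_zero]

theorem aeval_rootPoly_insert (θ : Module.End ℂ M) {s : Finset ℤ} {i : ℤ} (hi : i ∉ s) (f : M) :
    Polynomial.aeval θ (rootPoly (insert i s)) f =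
      Polynomial.aeval θ (rootPoly s) (θ f - (i : ℂ) • f) := by
  rw [rootPoly, Finset.prod_insert hi, mul_comm, map_mul, Module.End.mul_apply]
  simp [rootPoly, ← Int.cast_smul_eq_zsmul ℂ]

theorem mem_eigenKer_insert {θ : Module.End ℂ M} {s : Finset ℤ} {i : ℤ} (hi : i ∉ s) {f : M} :
    f ∈ eigenKer θ (insert i s) ↔ θ f - (i : ℂ) • f ∈ eigenKer θ s := by
  rw [mem_eigenKer, mem_eigenKer, aeval_rootPoly_insert θ hi]

theorem eigenKer_empty {θ : Module.End ℂ M} {f : M} (hf : f ∈ eigenKer θ ∅) : f = 0 := by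
  simpa [mem_eigenKer, rootPoly] using hf

theorem eq_zero_of_eigenvector {θ : Module.End ℂ M} {s : Finset ℤ} {i : ℤ} (hi : i ∉ s) {f : M}
    (h : θ f = (i : ℂ) • f) (hf : f ∈ eigenKer θ s) : f = 0 := by
  induction s using Finset.induction_on with
  | empty => exact eigenKer_empty hf
  | insert j s hj ih =>
    rw [Finset.mem_insert, not_or] at hi
    rw [mem_eigenKer_insert hj, h, ← sub_smul] at hf
    have hne : (i : ℂ) - (j : ℂ) ≠ 0 := sub_ne_zero.2 (by exact_mod_cast hi.1)
    exact ih hi.2 ((Submodule.smul_mem_iff _ hne).1 hf)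

variable {θ ω : Module.End ℂ M}

theorem aeval_rootPoly_raise (hc : ∀ f, θ (ω f) = ω (θ f) + ω f) (s : Finset ℤ) (f : M) :
    Polynomial.aeval θ (rootPoly (s.image (· + 1))) (ω f) =
      ω (Polynomial.aeval θ (rootPoly s) f) := by
  induction s using Finset.induction_on generalizing f with
  | empty => simp [rootPoly]
  | insert i s hi ih =>
    have hi' : i + 1 ∉ s.image (· + 1) := by simpa using hi
    rw [Finset.image_insert, aeval_rootPoly_insert θ hi', aeval_rootPoly_insert θ hi, ← ih, hc]
    congr 1
    simp only [map_sub, map_smul]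
    push_cast
    module

theorem image_add_one_Icc (a b : ℤ) :
    (Finset.Icc a b).image (· + 1) = Finset.Icc (a + 1) (b + 1) := by
  ext x
  simp only [Finset.mem_image, Finset.mem_Icc]
  constructor
  · rintro ⟨y, hy, rfl⟩; omega
  · intro h; exact ⟨x - 1, by omega, by omega⟩

theorem omega_mem_eigenKer (hc : ∀ f, θ (ω f) = ω (θ f) + ω f) {a b : ℤ} {f : M}
    (hf : f ∈ eigenKer θ (Finset.Icc a b)) : ω f ∈ eigenKer θ (Finset.Icc (a + 1) (b + 1)) := by
  rw [mem_eigenKer] at hf ⊢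
  rw [← image_add_one_Icc, aeval_rootPoly_raise hc, hf, map_zero]

/-- The lowest eigenvalue occurring in `g` can only come from the right-hand side of
`(θ + ω + l) g = r`, or else is `-l`. -/
theorem eigenKer_lower_bound (hc : ∀ f, θ (ω f) = ω (θ f) + ω f) {a b l m : ℤ} (hl : l ≤ m) {g : M}
    (hg : g ∈ eigenKer θ (Finset.Icc a b))
    (h : θ g + ω g + (l : ℂ) • g ∈ eigenKer θ (Finset.Icc (-m) b)) :
    g ∈ eigenKer θ (Finset.Icc (-m) b) := by
  obtain ⟨d, hd⟩ : ∃ d : ℕ, -m ≤ a + d := ⟨(-m - a).toNat, by omega⟩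
  induction d generalizing a with
  | zero => exact eigenKer_mono θ (Finset.Icc_subset_Icc_left (by simpa using hd)) hg
  | succ d ih =>
    by_cases ham : -m ≤ a
    · exact eigenKer_mono θ (Finset.Icc_subset_Icc_left ham) hg
    refine ih (a := a + 1) ?_ (by push_cast at hd; omega)
    by_cases hab : a ≤ b
    swap
    · rw [Finset.Icc_eq_empty hab] at hg
      rw [eigenKer_empty hg]; exact zero_mem _
    have ha : a ∉ Finset.Icc (a + 1) b := by simp
    have hins : Finset.Icc a b = insert a (Finset.Icc (a + 1) b) := by
      ext x; simp only [Finset.mem_Icc, Finset.mem_insert]; omega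
    have hb : b + 1 ∉ Finset.Icc (a + 1) b := by simp
    have hins' : Finset.Icc (a + 1) (b + 1) = insert (b + 1) (Finset.Icc (a + 1) b) := by
      ext x; simp only [Finset.mem_Icc, Finset.mem_insert]; omega
    set k := Polynomial.aeval θ (rootPoly (Finset.Icc (a + 1) b)) g with hk
    have hθk : θ k = (a : ℂ) • k := by
      have := hg
      rw [hins, mem_eigenKer_insert ha, mem_eigenKer, map_sub, map_smul, aeval_apply_comm] at this
      exact sub_eq_zero.1 this
    have h2 := eigenKer_mono θ (t := Finset.Icc (a + 1) (b + 1))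
      (Finset.Icc_subset_Icc (by omega) (by omega)) h
    have hω := omega_mem_eigenKer hc hg
    have h3 : θ g + (l : ℂ) • g ∈ eigenKer θ (Finset.Icc (a + 1) (b + 1)) := by
      have := sub_mem h2 hω
      convert this using 1; abel
    rw [hins', mem_eigenKer_insert hb, mem_eigenKer] at h3
    simp only [map_sub, map_add, map_smul, aeval_apply_comm, ← hk, hθk, smul_smul] at h3
    have h4 : (((a : ℂ) + l) * ((a : ℂ) - (b + 1))) • k = 0 := by
      rw [← h3]; push_cast; module
    have hne1 : (a : ℂ) + l ≠ 0 := by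
      have : a + l ≠ 0 := by omega
      exact_mod_cast this
    have hne2 : (a : ℂ) - (b + 1) ≠ 0 := by
      have : a - (b + 1) ≠ 0 := by omega
      exact_mod_cast this
    exact mem_eigenKer.2 ((smul_eq_zero.1 h4).resolve_left (mul_ne_zero hne1 hne2))

/-- The system satisfied by the components of a linear symmetry. -/
def ChainEq (θ ω : Module.End ℂ M) (f : ℤ → M) : Prop :=
  ∀ k : ℤ, θ (θ (f k)) - θ (f k) - (2 * (k : ℂ) ^ 2) • f k
    - ((k : ℂ) + 1 / 2) • (θ (f (k + 1)) - ((k : ℂ) + 1) • f (k + 1))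
    + ((k : ℂ) - 1 / 2) • (θ (f (k - 1)) + ((k : ℂ) - 1) • f (k - 1))
    + ω (θ (f k) - (k : ℂ) • f k + ((k : ℂ) - 1 / 2) • f (k - 1)) = 0

theorem int_add_half_ne_zero (k : ℤ) : (k : ℂ) + 1 / 2 ≠ 0 := by
  intro h
  have h2 : ((2 * k + 1 : ℤ) : ℂ) = 0 := by push_cast; linear_combination 2 * h
  have : (2 * k + 1 : ℤ) = 0 := by exact_mod_cast h2
  omega

theorem int_sub_half_ne_zero (k : ℤ) : (k : ℂ) - 1 / 2 ≠ 0 := by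
  have := int_add_half_ne_zero (k - 1)
  push_cast at this
  convert this using 1; ring

namespace ChainEq

variable {f : ℤ → M}

theorem up (h : ChainEq θ ω f) (k : ℤ) :
    ((k : ℂ) + 1 / 2) • (θ (f (k + 1)) - ((k + 1 : ℤ) : ℂ) • f (k + 1)) =
      θ (θ (f k)) - θ (f k) - (2 * (k : ℂ) ^ 2) • f k
      + ((k : ℂ) - 1 / 2) • (θ (f (k - 1)) + ((k : ℂ) - 1) • f (k - 1))
      + ω (θ (f k) - (k : ℂ) • f k + ((k : ℂ) - 1 / 2) • f (k - 1)) := by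
  have := h k
  push_cast
  linear_combination (norm := module) (-1 : ℂ) • this

theorem down (h : ChainEq θ ω f) (k : ℤ) :
    ((k : ℂ) - 1 / 2) • (θ (f (k - 1)) + ω (f (k - 1)) + ((k - 1 : ℤ) : ℂ) • f (k - 1)) =
      -(θ (θ (f k)) - θ (f k) - (2 * (k : ℂ) ^ 2) • f k
      - ((k : ℂ) + 1 / 2) • (θ (f (k + 1)) - ((k : ℂ) + 1) • f (k + 1))
      + ω (θ (f k) - (k : ℂ) • f k)) := by
  have := h k
  simp only [map_add, map_sub, map_smul] at this ⊢
  push_cast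
  linear_combination (norm := module) this

theorem mem_eigenKer_upper (hc : ∀ f, θ (ω f) = ω (θ f) + ω f) (h : ChainEq θ ω f) {N : ℤ}
    (hN : ∀ k < -N, f k = 0) (k : ℤ) : f k ∈ eigenKer θ (Finset.Icc (-N) k) := by
  suffices ∀ d : ℕ, ∀ k < -N + d, f k ∈ eigenKer θ (Finset.Icc (-N) k) by
    exact this (k + N + 1).toNat k (by omega)
  intro d
  induction d with
  | zero => intro k hk; rw [hN k (by simpa using hk)]; exact zero_mem _
  | succ d ih =>
    intro j hj
    obtain ⟨k, rfl⟩ : ∃ k, j = k + 1 := ⟨j - 1, by ring⟩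
    push_cast at hj
    by_cases hkN : k + 1 < -N
    · rw [hN _ hkN]; exact zero_mem _
    have h1 := ih k (by omega)
    have h2 := ih (k - 1) (by omega)
    have h2' := eigenKer_mono θ (t := Finset.Icc (-N) k) (Finset.Icc_subset_Icc_right (by omega)) h2
    have hk : k + 1 ∉ Finset.Icc (-N) k := by simp
    have hins : Finset.Icc (-N) (k + 1) = insert (k + 1) (Finset.Icc (-N) k) := by
      ext x; simp only [Finset.mem_Icc, Finset.mem_insert]; omega
    have h3 : θ (f k) - (k : ℂ) • f k ∈ eigenKer θ (Finset.Icc (-N) (k - 1)) := by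
      by_cases hk' : -N ≤ k
      · have hk2 : k ∉ Finset.Icc (-N) (k - 1) := by simp
        rw [← mem_eigenKer_insert hk2]
        convert h1 using 2
        ext x; simp only [Finset.mem_Icc, Finset.mem_insert]; omega
      · rw [hN k (by omega)]; simp
    have h4 := omega_mem_eigenKer hc (add_mem h3 (Submodule.smul_mem _ ((k : ℂ) - 1 / 2) h2))
    rw [sub_add_cancel] at h4
    have h5 := eigenKer_mono θ (t := Finset.Icc (-N) k) (Finset.Icc_subset_Icc_left (by omega)) h4
    rw [hins, mem_eigenKer_insert hk, ← Submodule.smul_mem_iff _ (int_add_half_ne_zero k), h.up k]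
    refine add_mem (add_mem (sub_mem (sub_mem ?_ ?_) ?_) ?_) h5
    · exact theta_mem_eigenKer (theta_mem_eigenKer h1)
    · exact theta_mem_eigenKer h1
    · exact Submodule.smul_mem _ _ h1
    · exact Submodule.smul_mem _ _ (add_mem (theta_mem_eigenKer h2') (Submodule.smul_mem _ _ h2'))

theorem mem_eigenKer_lower (hc : ∀ f, θ (ω f) = ω (θ f) + ω f) (h : ChainEq θ ω f) {N m : ℤ}
    (hN : ∀ k < -N, f k = 0) (hm : ∀ k > m, f k = 0) (k : ℤ) :
    ∀ b, m ≤ b → f k ∈ eigenKer θ (Finset.Icc (-m) (b + m - k)) := by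
  suffices ∀ d : ℕ, ∀ k > m - d, ∀ b, m ≤ b → f k ∈ eigenKer θ (Finset.Icc (-m) (b + m - k)) by
    exact this (m - k + 1).toNat k (by omega)
  intro d
  induction d with
  | zero => intro k hk b _; rw [hm k (by simpa using hk)]; exact zero_mem _
  | succ d ih =>
    intro j hj b hb
    obtain ⟨k, rfl⟩ : ∃ k, j = k - 1 := ⟨j + 1, by ring⟩
    push_cast at hj
    by_cases hkm : k - 1 > m
    · rw [hm _ hkm]; exact zero_mem _
    have h0 := eigenKer_mono θ (t := Finset.Icc (-N) (b + m - (k - 1)))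
      (Finset.Icc_subset_Icc_right (by omega)) (h.mem_eigenKer_upper hc hN (k - 1))
    refine eigenKer_lower_bound hc (l := k - 1) (by omega) h0 ?_
    rw [← Submodule.smul_mem_iff _ (int_sub_half_ne_zero k), h.down k]
    have h1 := ih k (by omega) b hb
    have h1' := eigenKer_mono θ (t := Finset.Icc (-m) (b + m - (k - 1)))
      (Finset.Icc_subset_Icc_right (by omega)) h1
    have h2 := eigenKer_mono θ (t := Finset.Icc (-m) (b + m - (k - 1)))
      (Finset.Icc_subset_Icc_right (by omega)) (ih (k + 1) (by omega) b hb)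
    have h4 := eigenKer_mono θ (t := Finset.Icc (-m) (b + m - (k - 1)))
      (Finset.Icc_subset_Icc (by omega) (by omega))
      (omega_mem_eigenKer hc (sub_mem (theta_mem_eigenKer h1) (Submodule.smul_mem _ (k : ℂ) h1)))
    refine neg_mem (add_mem (sub_mem (sub_mem (sub_mem ?_ ?_) ?_) ?_) h4)
    · exact theta_mem_eigenKer (theta_mem_eigenKer h1')
    · exact theta_mem_eigenKer h1'
    · exact Submodule.smul_mem _ _ h1'
    · exact Submodule.smul_mem _ _ (sub_mem (theta_mem_eigenKer h2) (Submodule.smul_mem _ _ h2))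

theorem top_eq (h : ChainEq θ ω f) {n : ℤ} (hn : ∀ k > n, f k = 0) :
    θ (f n) + ω (f n) + (n : ℂ) • f n = 0 := by
  have := h.down (n + 1)
  rw [hn (n + 1) (by omega), hn (n + 1 + 1) (by omega), add_sub_cancel_right] at this
  simpa [int_sub_half_ne_zero] using (smul_eq_zero.1 (this.trans (by simp))).resolve_left
    (int_sub_half_ne_zero (n + 1))

theorem bottom_eq (h : ChainEq θ ω f) {n : ℤ} (hn : ∀ k < n, f k = 0) :
    θ (f n) = (n : ℂ) • f n := by
  have := h.up (n - 1)
  rw [hn (n - 1) (by omega), hn (n - 1 - 1) (by omega), sub_add_cancel] at this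
  exact sub_eq_zero.1 ((smul_eq_zero.1 (this.trans (by simp))).resolve_left
    (int_add_half_ne_zero (n - 1)))

theorem top_mem (hc : ∀ f, θ (ω f) = ω (θ f) + ω f) (h : ChainEq θ ω f) {N n : ℤ}
    (hN : ∀ k < -N, f k = 0) (hn : ∀ k > n, f k = 0) : f n ∈ eigenKer θ (Finset.Icc (-n) n) :=
  eigenKer_lower_bound hc le_rfl (h.mem_eigenKer_upper hc hN n) (by
    rw [h.top_eq hn]; exact zero_mem _)

/-- The support of a solution is not longer below than it is above. -/
theorem bottom_eq_zero (hc : ∀ f, θ (ω f) = ω (θ f) + ω f) (h : ChainEq θ ω f) {n m : ℤ}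
    (hmn : m < n) (hn : ∀ k < -n, f k = 0) (hm : ∀ k > m, f k = 0) : f (-n) = 0 := by
  refine eq_zero_of_eigenvector ?_ (h.bottom_eq hn) (h.mem_eigenKer_lower hc hn hm (-n) m le_rfl)
  simp; omega

end ChainEq

theorem omega_pow_top (hc : ∀ f, θ (ω f) = ω (θ f) + ω f) {n : ℤ} {f : M}
    (h : θ f + ω f + (n : ℂ) • f = 0) (d : ℕ) :
    (ω ^ d) f =
      ((-1 : ℂ) ^ d) • Polynomial.aeval θ (rootPoly (Finset.Icc (-n) (-n + d - 1))) f := by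
  have hω : ω f = -(θ f + (n : ℂ) • f) := by linear_combination (norm := module) h
  induction d with
  | zero => simp [rootPoly]
  | succ d ih =>
    have hins : Finset.Icc (-n) (-n + (d + 1 : ℕ) - 1) =
        insert (-n) (Finset.Icc (-n + 1) (-n + d - 1 + 1)) := by
      ext x; simp only [Finset.mem_Icc, Finset.mem_insert]; push_cast; omega
    have hn : -n ∉ Finset.Icc (-n + 1) (-n + d - 1 + 1) := by simp
    rw [pow_succ', Module.End.mul_apply, ih, map_smul, ← aeval_rootPoly_raise hc,
      image_add_one_Icc, hω, hins, aeval_rootPoly_insert θ hn, pow_succ, map_neg, mul_neg_one,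
      neg_smul, smul_neg]
    congr 3
    push_cast
    module

theorem ChainEq.omega_pow_eq_zero (hc : ∀ f, θ (ω f) = ω (θ f) + ω f) {f : ℤ → M}
    (h : ChainEq θ ω f) {N : ℤ} {n : ℕ} (hN : ∀ k < -N, f k = 0) (hn : ∀ k > (n : ℤ), f k = 0) :
    (ω ^ (2 * n + 1)) (f n) = 0 := by
  have h1 := omega_pow_top hc (h.top_eq hn) (2 * n + 1)
  have h2 := mem_eigenKer.1 (h.top_mem hc hN hn)
  rw [h1, show -(n : ℤ) + (2 * n + 1 : ℕ) - 1 = n by push_cast; ring, h2, smul_zero]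

end Ladder

section VerticalLadder

variable {M : Type*} [AddCommGroup M] [Module ℂ M] {θ ω : Module.End ℂ M} {E : ℤ → Module.End ℂ M}

/-- Operators `E k` which commute with `θ` and `ω` up to multiples of each other, and of which only
finitely many act nontrivially on each element. -/
structure IsLadder (θ ω : Module.End ℂ M) (E : ℤ → Module.End ℂ M) : Prop where
  theta_omega : ∀ f, θ (ω f) = ω (θ f) + ω f
  E_theta : ∀ k f, E k (θ f) = θ (E k f) - ((k : ℂ) + 1 / 2) • E k f
    + ((k : ℂ) - 1 / 2) • E (k - 1) f
  E_omega : ∀ k f, E k (ω f) = ω (E k f) + (2 * (k : ℂ)) • E k f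
    - ((k : ℂ) + 1 / 2) • E (k + 1) f - ((k : ℂ) - 1 / 2) • E (k - 1) f
  finite : ∀ f, ∃ N : ℕ, ∀ k : ℤ, (N : ℤ) < |k| → E k f = 0

/-- The elements killed by all `E k`. -/
def horizontal (E : ℤ → Module.End ℂ M) : Submodule ℂ M := ⨅ k, LinearMap.ker (E k)

theorem mem_horizontal {f : M} : f ∈ horizontal E ↔ ∀ k, E k f = 0 := by
  simp [horizontal]

namespace IsLadder

theorem theta_mem (H : IsLadder θ ω E) {f : M} (hf : f ∈ horizontal E) : θ f ∈ horizontal E := by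
  rw [mem_horizontal] at hf ⊢
  intro k; rw [H.E_theta]; simp [hf]

theorem omega_mem (H : IsLadder θ ω E) {f : M} (hf : f ∈ horizontal E) : ω f ∈ horizontal E := by
  rw [mem_horizontal] at hf ⊢
  intro k; rw [H.E_omega]; simp [hf]

theorem mem_of_theta_add_omega (H : IsLadder θ ω E) {f : M} {c : ℂ}
    (hf : θ f + ω f + c • f ∈ horizontal E) :
    f ∈ horizontal E := by
  rw [mem_horizontal] at hf ⊢
  obtain ⟨N, hN⟩ := H.finite f
  suffices ∀ d : ℕ, ∀ k < -(N : ℤ) + d, E k f = 0 by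
    intro k; exact this (k + N + 1).toNat k (by omega)
  intro d
  induction d with
  | zero => intro k hk; exact hN k (by rw [lt_abs]; right; simp at hk; omega)
  | succ d ih =>
    intro j hj
    obtain ⟨k, rfl⟩ : ∃ k, j = k + 1 := ⟨j - 1, by ring⟩
    push_cast at hj
    have h0 := ih k (by omega)
    have h1 := hf k
    rw [map_add, map_add, map_smul, H.E_theta, H.E_omega, h0] at h1
    simp only [map_zero, smul_zero] at h1
    refine (smul_eq_zero.1 (?_ : ((k : ℂ) + 1 / 2) • E (k + 1) f = 0)).resolve_left
      (int_add_half_ne_zero k)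
    linear_combination (norm := module) (-1 : ℂ) • h1

theorem chainEq (H : IsLadder θ ω E) {f : M} (hf : θ (θ f) + ω (θ f) + (1 / 2 : ℂ) • ω f = 0) :
    ChainEq θ ω fun k => E k f := by
  intro k
  have h := congrArg (E k) hf
  simp only [map_add, map_smul, map_sub, map_zero, H.E_theta, H.E_omega,
    add_sub_cancel_right] at h
  push_cast at h
  simp only [map_add, map_smul, map_sub]
  linear_combination (norm := module) h

theorem component_mem (H : IsLadder θ ω E) {f : M}
    (hf : θ (θ f) + ω (θ f) + (1 / 2 : ℂ) • ω f = 0) (k : ℤ) :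
    E k f ∈ horizontal E := by
  have h := H.chainEq hf
  obtain ⟨N, hN⟩ := H.finite f
  suffices ∀ d : ℕ, ∀ k > (N : ℤ) - d, E k f ∈ horizontal E by
    exact this (N - k + 1).toNat k (by omega)
  intro d
  induction d with
  | zero =>
    intro k hk
    rw [hN k (by rw [lt_abs]; left; simpa using hk)]; exact zero_mem _
  | succ d ih =>
    intro j hj
    obtain ⟨k, rfl⟩ : ∃ k, j = k - 1 := ⟨j + 1, by ring⟩
    push_cast at hj
    refine H.mem_of_theta_add_omega (c := ((k - 1 : ℤ) : ℂ)) ?_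
    rw [← Submodule.smul_mem_iff _ (int_sub_half_ne_zero k), h.down k]
    have h1 := ih k (by omega)
    have h2 := ih (k + 1) (by omega)
    refine neg_mem (add_mem (sub_mem (sub_mem (sub_mem ?_ ?_) ?_) ?_) ?_)
    · exact H.theta_mem (H.theta_mem h1)
    · exact H.theta_mem h1
    · exact Submodule.smul_mem _ _ h1
    · exact Submodule.smul_mem _ _ (sub_mem (H.theta_mem h2) (Submodule.smul_mem _ _ h2))
    · exact H.omega_mem (sub_mem (H.theta_mem h1) (Submodule.smul_mem _ _ h1))

end IsLadder

end VerticalLadder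

section RecursionOperators

variable {A : Type} [Field A] [Algebra ℝ A]

/-- `D₁` and `D₂` are commuting derivations for which `x` and `y` behave as coordinates. -/
structure IsFrame (x y : A) (D₁ D₂ : Derivation ℝ A A) : Prop where
  d₁x : D₁ x = 1
  d₁y : D₁ y = 0
  d₂x : D₂ x = 0
  d₂y : D₂ y = 1
  comm : ∀ f, D₁ (D₂ f) = D₂ (D₁ f)

/-- `(x + y)(D₁² + D₂²) + D₁ + D₂`. -/
def edOp (x y : A) (D₁ D₂ : Derivation ℝ A A) : Module.End ℝ A :=
  (x + y) • ((D₁ : A →ₗ[ℝ] A) * (D₁ : A →ₗ[ℝ] A) + (D₂ : A →ₗ[ℝ] A) * (D₂ : A →ₗ[ℝ] A)) +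
    (D₁ : A →ₗ[ℝ] A) + (D₂ : A →ₗ[ℝ] A)

theorem edOp_apply (x y : A) (D₁ D₂ : Derivation ℝ A A) (f : A) :
    edOp x y D₁ D₂ f = (x + y) * (D₁ (D₁ f) + D₂ (D₂ f)) + D₁ f + D₂ f := rfl

theorem boxOp_apply (D₁ D₂ : Derivation ℝ A A) (f : A) : boxOp D₁ D₂ f = -D₁ f + D₂ f := rfl

theorem sigmaOp_apply (x y : A) (D₁ D₂ : Derivation ℝ A A) (f : A) :
    sigmaOp x y D₁ D₂ f = x * D₁ f + y * D₂ f + 1 / 2 * f := rfl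

theorem tauOp_apply (x y : A) (D₁ D₂ : Derivation ℝ A A) (f : A) :
    tauOp x y D₁ D₂ f = (x ^ 2 / 2 - x * y - y ^ 2 / 2) * D₁ f +
      (x ^ 2 / 2 + x * y - y ^ 2 / 2) * D₂ f + (x - y) / 2 * f := rfl

theorem derivation_half_mul (D : Derivation ℝ A A) (f : A) : D (1 / 2 * f) = 1 / 2 * D f := by
  have h : (1 / 2 : A) = algebraMap ℝ A (1 / 2) := by
    rw [map_div₀, map_one, map_ofNat]
  rw [h, ← Algebra.smul_def, D.map_smul, Algebra.smul_def]

theorem derivation_half (D : Derivation ℝ A A) : D (1 / 2) = 0 := by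
  simpa using derivation_half_mul D 1

namespace IsFrame

variable {x y : A} {D₁ D₂ : Derivation ℝ A A}

theorem charZero (_ : IsFrame x y D₁ D₂) : CharZero A :=
  charZero_of_injective_algebraMap (algebraMap ℝ A).injective

theorem derivation_tau_coeff (_ : IsFrame x y D₁ D₂) (D : Derivation ℝ A A) :
    D (x ^ 2 / 2 - x * y - y ^ 2 / 2) = x * D x - x * D y - y * D x - y * D y ∧
    D (x ^ 2 / 2 + x * y - y ^ 2 / 2) = x * D x + x * D y + y * D x - y * D y ∧
    D ((x - y) / 2) = (D x - D y) / 2 := by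
  have : CharZero A := charZero_of_injective_algebraMap (algebraMap ℝ A).injective
  have h : ∀ f : A, D (f / 2) = D f / 2 := fun f => by
    have := derivation_half_mul D f
    rw [div_eq_inv_mul, div_eq_inv_mul]; simpa using this
  refine ⟨?_, ?_, ?_⟩ <;>
  simp only [map_sub, map_add, h, sq, Derivation.leibniz, smul_eq_mul] <;> ring

theorem box_tau (H : IsFrame x y D₁ D₂) :
    ⁅boxOp D₁ D₂, tauOp x y D₁ D₂⁆ = (-2 : ℝ) • sigmaOp x y D₁ D₂ := by
  have := H.charZero
  ext f
  obtain ⟨a1, b1, c1⟩ := H.derivation_tau_coeff D₁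
  obtain ⟨a2, b2, c2⟩ := H.derivation_tau_coeff D₂
  rw [LinearMap.smul_apply, Algebra.smul_def, map_neg, map_ofNat]
  simp only [Ring.lie_def, LinearMap.sub_apply, Module.End.mul_apply,
    boxOp_apply, tauOp_apply, sigmaOp_apply, map_add, map_neg, Derivation.leibniz, smul_eq_mul,
    a1, b1, c1, a2, b2, c2, H.d₁x, H.d₁y, H.d₂x, H.d₂y, H.comm]
  ring

theorem box_sigma (H : IsFrame x y D₁ D₂) : ⁅boxOp D₁ D₂, sigmaOp x y D₁ D₂⁆ = boxOp D₁ D₂ := by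
  have := H.charZero
  ext f
  simp only [Ring.lie_def, LinearMap.sub_apply, Module.End.mul_apply,
    boxOp_apply, sigmaOp_apply, map_add, map_neg, Derivation.leibniz,
    derivation_half, smul_eq_mul, H.d₁x, H.d₁y, H.d₂x, H.d₂y, H.comm]
  ring

theorem sigma_tau (H : IsFrame x y D₁ D₂) :
    ⁅sigmaOp x y D₁ D₂, tauOp x y D₁ D₂⁆ = tauOp x y D₁ D₂ := by
  have := H.charZero
  ext f
  obtain ⟨a1, b1, c1⟩ := H.derivation_tau_coeff D₁
  obtain ⟨a2, b2, c2⟩ := H.derivation_tau_coeff D₂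
  simp only [Ring.lie_def, LinearMap.sub_apply, Module.End.mul_apply, derivation_half,
    tauOp_apply, sigmaOp_apply, map_add, Derivation.leibniz, smul_eq_mul,
    a1, b1, c1, a2, b2, c2, H.d₁x, H.d₁y, H.d₂x, H.d₂y, H.comm]
  ring

theorem edOp_box (H : IsFrame x y D₁ D₂) (f : A) :
    edOp x y D₁ D₂ (boxOp D₁ D₂ f) = boxOp D₁ D₂ (edOp x y D₁ D₂ f) := by
  simp only [boxOp_apply, edOp_apply, map_add, map_neg, Derivation.leibniz,
    smul_eq_mul, H.d₁x, H.d₁y, H.d₂x, H.d₂y, H.comm]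
  ring

theorem edOp_sigma (H : IsFrame x y D₁ D₂) (f : A) :
    edOp x y D₁ D₂ (sigmaOp x y D₁ D₂ f) =
      sigmaOp x y D₁ D₂ (edOp x y D₁ D₂ f) + edOp x y D₁ D₂ f := by
  have := H.charZero
  simp only [sigmaOp_apply, edOp_apply, map_add, derivation_half, Derivation.leibniz,
    smul_eq_mul, H.d₁x, H.d₁y, H.d₂x, H.d₂y, H.comm, map_zero, Derivation.map_one_eq_zero]
  ring

theorem edOp_tau (H : IsFrame x y D₁ D₂) (f : A) :
    edOp x y D₁ D₂ (tauOp x y D₁ D₂ f) =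
      tauOp x y D₁ D₂ (edOp x y D₁ D₂ f) + (x - y) * edOp x y D₁ D₂ f := by
  have := H.charZero
  have h : ∀ (D : Derivation ℝ A A) (f : A), D (f / 2) = D f / 2 := fun D f => by
    have := derivation_half_mul D f
    rw [div_eq_inv_mul, div_eq_inv_mul]; simpa using this
  simp only [tauOp_apply, edOp_apply, map_add, map_sub, h, Derivation.leibniz, smul_eq_mul,
    H.d₁x, H.d₁y, H.d₂x, H.d₂y, H.comm, map_zero,
    Derivation.map_one_eq_zero, sq]
  ring

end IsFrame

end RecursionOperators

section Bracket

variable {R : Type*} [Ring R]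

theorem ring_lie_mul (X Y t : R) : ⁅X * Y, t⁆ = ⁅X, t⁆ * Y + X * ⁅Y, t⁆ := by
  simp only [Ring.lie_def, mul_sub, sub_mul, mul_assoc]; abel

theorem ring_lie_lie (X t s : R) : ⁅⁅X, t⁆, s⁆ = ⁅⁅X, s⁆, t⁆ + ⁅X, ⁅t, s⁆⁆ := by
  simp only [Ring.lie_def, mul_sub, sub_mul, mul_assoc]; abel

theorem ring_lie_swap (X Y : R) : ⁅X, Y⁆ = -⁅Y, X⁆ := by simp only [Ring.lie_def, neg_sub]

theorem ring_lie_self (X : R) : ⁅X, X⁆ = 0 := by simp only [Ring.lie_def, sub_self]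

theorem ring_zero_lie (X : R) : ⁅(0 : R), X⁆ = 0 := by
  simp only [Ring.lie_def, zero_mul, mul_zero, sub_self]

theorem ring_add_lie (X Y t : R) : ⁅X + Y, t⁆ = ⁅X, t⁆ + ⁅Y, t⁆ := by
  simp only [Ring.lie_def, mul_add, add_mul]; abel

theorem ring_lie_neg (X Y : R) : ⁅X, -Y⁆ = -⁅X, Y⁆ := by
  simp only [Ring.lie_def, mul_neg, neg_mul]; abel

theorem end_smul_lie {A : Type*} [AddCommGroup A] [Module ℝ A] (c : ℝ)
    (X Y : Module.End ℝ A) : ⁅c • X, Y⁆ = c • ⁅X, Y⁆ := by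
  simp only [Ring.lie_def, smul_mul_assoc, mul_smul_comm, smul_sub]

theorem end_lie_smul {A : Type*} [AddCommGroup A] [Module ℝ A] (c : ℝ)
    (X Y : Module.End ℝ A) : ⁅X, c • Y⁆ = c • ⁅X, Y⁆ := by
  simp only [Ring.lie_def, smul_mul_assoc, mul_smul_comm, smul_sub]

end Bracket

section Triple

variable {A : Type} [Field A] [Algebra ℝ A] {e s t : Module.End ℝ A}

/-- The commutation relations of the recursion operators. -/
structure IsTriple (e s t : Module.End ℝ A) : Prop where
  et : ⁅e, t⁆ = (-2 : ℝ) • s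
  es : ⁅e, s⁆ = e
  st : ⁅s, t⁆ = t

namespace IsTriple

theorem lie_s (H : IsTriple e s t) (m j : ℕ) :
    ⁅iterComm (e ^ m) t j, s⁆ = ((m : ℝ) - j) • iterComm (e ^ m) t j := by
  induction j with
  | zero =>
    simp only [iterComm, Nat.cast_zero, sub_zero]
    induction m with
    | zero => simp [Ring.lie_def]
    | succ m ih =>
      rw [pow_succ, ring_lie_mul, ih, H.es, smul_mul_assoc]
      push_cast; module
  | succ j ih =>
    rw [iterComm, ring_lie_lie, ih, ring_lie_swap t s, H.st, end_smul_lie, ring_lie_neg]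
    push_cast; module

theorem lie_e (H : IsTriple e s t) (m j : ℕ) :
    ⁅iterComm (e ^ m) t (j + 1), e⁆ =
      (((j : ℝ) + 1) * (2 * m - j)) • iterComm (e ^ m) t j := by
  have hte : ⁅t, e⁆ = (2 : ℝ) • s := by rw [ring_lie_swap, H.et]; module
  have hstep : ∀ j, ⁅iterComm (e ^ m) t (j + 1), e⁆ =
      ⁅⁅iterComm (e ^ m) t j, e⁆, t⁆ + (2 * ((m : ℝ) - j)) • iterComm (e ^ m) t j := by
    intro j
    rw [iterComm, ring_lie_lie, hte, end_lie_smul, H.lie_s, smul_smul]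
  induction j with
  | zero =>
    have : ⁅iterComm (e ^ m) t 0, e⁆ = 0 := by
      simp only [iterComm, Ring.lie_def, ← pow_succ, ← pow_succ', sub_self]
    rw [hstep, this, ring_zero_lie]; simp
  | succ j ih =>
    rw [hstep, ih, end_smul_lie]
    change _ • iterComm (e ^ m) t (j + 1) + _ = _
    push_cast; module

theorem iterComm_mul_e (H : IsTriple e s t) (B : Module.End ℝ A) (j : ℕ) :
    iterComm (B * e) t (j + 2) = iterComm B t (j + 2) * e +
      ((j : ℝ) + 2) • (iterComm B t (j + 1) * ⁅e, t⁆) +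
      (((j : ℝ) + 2) * (j + 1) / 2) • (iterComm B t j * ⁅⁅e, t⁆, t⁆) := by
  have h3 : ⁅⁅⁅e, t⁆, t⁆, t⁆ = 0 := by
    rw [H.et, end_smul_lie, H.st, end_smul_lie, ring_lie_self, smul_zero]
  induction j with
  | zero =>
    simp only [iterComm, ring_lie_mul, ring_add_lie]
    push_cast; module
  | succ j ih =>
    rw [iterComm, ih, ring_add_lie, ring_add_lie, end_smul_lie, end_smul_lie, ring_lie_mul,
      ring_lie_mul, ring_lie_mul, h3]
    change iterComm B t (j + 3) * e + iterComm B t (j + 2) * ⁅e, t⁆ +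
      ((j : ℝ) + 2) • (iterComm B t (j + 2) * ⁅e, t⁆ + iterComm B t (j + 1) * ⁅⁅e, t⁆, t⁆) +
      (((j : ℝ) + 2) * (j + 1) / 2) • (iterComm B t (j + 1) * ⁅⁅e, t⁆, t⁆ + iterComm B t j * 0) = _
    rw [mul_zero]
    push_cast; module

theorem iterComm_eq_zero (H : IsTriple e s t) (m j : ℕ) (hj : 2 * m < j) :
    iterComm (e ^ m) t j = 0 := by
  induction m generalizing j with
  | zero =>
    obtain ⟨j, rfl⟩ : ∃ i, j = i + 1 := ⟨j - 1, by omega⟩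
    clear hj
    induction j with
    | zero => simp [iterComm, Ring.lie_def]
    | succ j ih => rw [iterComm, ih, ring_zero_lie]
  | succ m ih =>
    obtain ⟨j, rfl⟩ : ∃ i, j = i + 2 := ⟨j - 2, by omega⟩
    rw [pow_succ, H.iterComm_mul_e, ih _ (by omega), ih _ (by omega), ih _ (by omega)]
    simp

theorem iterComm_mem (H : IsTriple e s t) (m j : ℕ) :
    iterComm (e ^ m) t j ∈ Submodule.span ℝ {e, s, t} ^ m := by
  have hspan : ∀ X ∈ Submodule.span ℝ {e, s, t}, ⁅X, t⁆ ∈ Submodule.span ℝ {e, s, t} := by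
    intro X hX
    induction hX using Submodule.span_induction with
    | mem X hX =>
      rcases hX with rfl | rfl | rfl
      · rw [H.et]; exact Submodule.smul_mem _ _ (Submodule.subset_span (by simp))
      · rw [H.st]; exact Submodule.subset_span (by simp)
      · rw [ring_lie_self]; exact zero_mem _
    | zero => rw [ring_zero_lie]; exact zero_mem _
    | add X Y _ _ hX hY => rw [ring_add_lie]; exact add_mem hX hY
    | smul c X _ hX => rw [end_smul_lie]; exact Submodule.smul_mem _ _ hX
  have hpow : ∀ m, ∀ X ∈ Submodule.span ℝ {e, s, t} ^ m,
      ⁅X, t⁆ ∈ Submodule.span ℝ {e, s, t} ^ m := by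
    intro m
    induction m with
    | zero =>
      intro X hX
      rw [Submodule.pow_zero, Submodule.mem_one] at hX
      obtain ⟨c, rfl⟩ := hX
      rw [Ring.lie_def, Algebra.commutes, sub_self]
      exact zero_mem _
    | succ m ih =>
      intro X hX
      rw [Submodule.pow_succ] at hX ⊢
      induction hX using Submodule.mul_induction_on' with
      | mem_mul_mem X hX Y hY =>
        rw [ring_lie_mul]
        exact add_mem (Submodule.mul_mem_mul (ih X hX) hY) (Submodule.mul_mem_mul hX (hspan Y hY))
      | add X _ Y _ hX hY => rw [ring_add_lie]; exact add_mem hX hY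
  induction j with
  | zero => exact Submodule.pow_mem_pow _ (Submodule.subset_span (by simp)) m
  | succ j ih => exact hpow m _ ih

end IsTriple

theorem apply_mem_of_mem_span_pow {F : ℕ → Submodule ℝ A}
    (h : ∀ r, ∀ f ∈ F r, e f ∈ F (r + 1) ∧ s f ∈ F (r + 1) ∧ t f ∈ F (r + 1)) {m : ℕ}
    {C : Module.End ℝ A} (hC : C ∈ Submodule.span ℝ {e, s, t} ^ m) {r : ℕ} {f : A}
    (hf : f ∈ F r) : C f ∈ F (r + m) := by
  induction m generalizing C r f with
  | zero =>
    rw [Submodule.pow_zero, Submodule.mem_one] at hC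
    obtain ⟨c, rfl⟩ := hC
    exact Submodule.smul_mem _ c hf
  | succ m ih =>
    rw [Submodule.pow_succ] at hC
    induction hC using Submodule.mul_induction_on' with
    | mem_mul_mem X hX Y hY =>
      have hYf : Y f ∈ F (r + 1) := by
        induction hY using Submodule.span_induction with
        | mem Y hY =>
          rcases hY with rfl | rfl | rfl
          exacts [(h r f hf).1, (h r f hf).2.1, (h r f hf).2.2]
        | zero => exact zero_mem _
        | add X Y _ _ hX hY => exact add_mem hX hY
        | smul c X _ hX => exact Submodule.smul_mem _ _ hX
      have := ih hX hYf
      rwa [show r + 1 + m = r + (m + 1) by ring] at this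
    | add X _ Y _ hX hY => exact add_mem hX hY

end Triple

section FrameTriple

variable {A : Type} [Field A] [Algebra ℝ A] {x y : A} {D₁ D₂ : Derivation ℝ A A}

theorem IsFrame.isTriple (H : IsFrame x y D₁ D₂) :
    IsTriple (boxOp D₁ D₂) (sigmaOp x y D₁ D₂) (tauOp x y D₁ D₂) :=
  ⟨H.box_tau, H.box_sigma, H.sigma_tau⟩

theorem IsFrame.edOp_iterComm (H : IsFrame x y D₁ D₂) {f : A} (hf : edOp x y D₁ D₂ f = 0)
    (m j : ℕ) :
    edOp x y D₁ D₂ (iterComm (boxOp D₁ D₂ ^ m) (tauOp x y D₁ D₂) j f) = 0 := by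
  refine apply_mem_of_mem_span_pow (F := fun _ => LinearMap.ker (edOp x y D₁ D₂)) ?_
    (H.isTriple.iterComm_mem m j) (r := 0) hf
  intro _ g hg
  simp only [LinearMap.mem_ker] at hg ⊢
  rw [H.edOp_box, H.edOp_sigma, H.edOp_tau, hg]
  simp

end FrameTriple

section PartialDerivatives

variable {v : Type}

/-- The partial derivative with respect to the variable `i`. -/
def partialDer (i : v) : Derivation ℝ (RatFun v) (RatFun v) :=
  fracDer fun j => algebraMap (MvPolynomial v ℝ) (RatFun v) (pderiv i (X j))

theorem partialDer_algebraMap (i : v) (p : MvPolynomial v ℝ) :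
    partialDer i (algebraMap _ (RatFun v) p) = algebraMap _ (RatFun v) (pderiv i p) := by
  rw [partialDer, fracDer_algebraMap]
  induction p using MvPolynomial.induction_on with
  | C c => simp
  | add p q hp hq => simp only [map_add, hp, hq]
  | mul_X p j hp =>
    simp only [Derivation.leibniz, hp, mkDerivation_X, smul_eq_mul, map_add, map_mul,
      Algebra.smul_def]

theorem partialDer_coord_self (i : v) : partialDer i (coord i) = 1 := by
  simp [partialDer, fracDer_coord]

theorem partialDer_coord_of_ne {i j : v} (h : j ≠ i) : partialDer i (coord j) = 0 := by
  simp [partialDer, fracDer_coord, pderiv_X_of_ne h]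

theorem exists_finset_derivation_eq_sum (f : RatFun v) :
    ∃ T : Finset v, ∀ D : Derivation ℝ (RatFun v) (RatFun v),
      D f = ∑ i ∈ T, D (coord i) * partialDer i f := by
  classical
  obtain ⟨p, q, -, rfl⟩ := IsFractionRing.div_surjective (A := MvPolynomial v ℝ) f
  refine ⟨p.vars ∪ q.vars, fun D => ?_⟩
  set D' : Derivation ℝ (RatFun v) (RatFun v) :=
    ∑ i ∈ p.vars ∪ q.vars, D (coord i) • partialDer i with hD'
  have happ : ∀ g, D' g = ∑ i ∈ p.vars ∪ q.vars, D (coord i) * partialDer i g := by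
    intro g
    have : ∀ S : Finset v, (∑ i ∈ S, D (coord i) • partialDer i : Derivation ℝ _ (RatFun v)) g =
        ∑ i ∈ S, D (coord i) * partialDer i g := by
      intro S
      induction S using Finset.induction_on with
      | empty => rfl
      | insert j S hj ih =>
        rw [Finset.sum_insert hj, Finset.sum_insert hj, Derivation.add_apply, ih]; rfl
    exact this _
  have hc : ∀ j ∈ p.vars ∪ q.vars, D (coord j) = D' (coord j) := by
    intro j hj
    rw [happ, Finset.sum_eq_single_of_mem j hj, partialDer_coord_self, mul_one]
    intro i _ hij
    rw [partialDer_coord_of_ne hij.symm, mul_zero]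
  have hp : ∀ r : MvPolynomial v ℝ, r.vars ⊆ p.vars ∪ q.vars →
      D (algebraMap _ _ r) = D' (algebraMap _ _ r) := by
    intro r hr
    exact MvPolynomial.derivation_eq_of_forall_mem_vars
      (D₁ := D.compAlgebraMap (MvPolynomial v ℝ)) (D₂ := D'.compAlgebraMap (MvPolynomial v ℝ))
      fun i hi => hc i (hr hi)
  rw [← happ, Derivation.leibniz_div, Derivation.leibniz_div, hp p Finset.subset_union_left,
    hp q Finset.subset_union_right]

theorem derivation_congr {D₁ D₂ : Derivation ℝ (RatFun v) (RatFun v)} {f : RatFun v}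
    (h : ∀ i, partialDer i f ≠ 0 → D₁ (coord i) = D₂ (coord i)) : D₁ f = D₂ f := by
  obtain ⟨T, hT⟩ := exists_finset_derivation_eq_sum f
  rw [hT, hT]
  refine Finset.sum_congr rfl fun i _ => ?_
  by_cases hi : partialDer i f = 0
  · rw [hi, mul_zero, mul_zero]
  · rw [h i hi]

theorem finite_partialDer_ne_zero (f : RatFun v) : {i | partialDer i f ≠ 0}.Finite := by
  obtain ⟨T, hT⟩ := exists_finset_derivation_eq_sum f
  refine T.finite_toSet.subset fun i hi => ?_
  by_contra hiT
  refine hi ?_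
  rw [hT (partialDer i)]
  refine Finset.sum_eq_zero fun j hj => ?_
  rw [partialDer_coord_of_ne, zero_mul]
  rintro rfl
  exact hiT hj

theorem notMem_vars_of_pderiv_eq_zero {i : v} {p : MvPolynomial v ℝ} (h : pderiv i p = 0) :
    i ∉ p.vars := by
  intro hi
  obtain ⟨m, hm, hmi⟩ := (mem_vars_iff_mem_support i).1 hi
  have hmi' : m i ≠ 0 := Finsupp.mem_support_iff.1 hmi
  have := coeff_pderiv (i := i) p (m - Finsupp.single i 1)
  have hm1 : m - Finsupp.single i 1 + Finsupp.single i 1 = m :=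
    tsub_add_cancel_of_le (by simpa [Finsupp.single_le_iff, Nat.one_le_iff_ne_zero] using hmi')
  rw [h, coeff_zero, hm1] at this
  rcases mul_eq_zero.1 this.symm with h | h
  · exact mem_support_iff.1 hm h
  · exact (by positivity : ((m - Finsupp.single i 1 : v →₀ ℕ) i : ℝ) + 1 ≠ 0) h

theorem pderiv_eq_zero_of_dvd {i : v} {q : MvPolynomial v ℝ} (h : q ∣ pderiv i q) :
    pderiv i q = 0 := by
  by_contra h0
  have hq : q ≠ 0 := by rintro rfl; simp at h0
  obtain ⟨r, hr⟩ := h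
  have hr0 : r ≠ 0 := by rintro rfl; simp [hr] at h0
  have h1 : degreeOf i q ≤ degreeOf i (pderiv i q) := by
    rw [hr, degreeOf_mul_eq hq hr0]; omega
  obtain ⟨m, hm⟩ := (support_nonempty (p := pderiv i q)).2 h0
  have hpos : ∀ m ∈ (pderiv i q).support, m i + 1 ≤ degreeOf i q := by
    intro m hm
    rw [mem_support_iff, coeff_pderiv] at hm
    have := monomial_le_degreeOf i (mem_support_iff.2 (left_ne_zero_of_mul hm))
    simpa using this
  have h2 : degreeOf i (pderiv i q) ≤ degreeOf i q - 1 :=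
    degreeOf_le_iff.2 fun m hm => by have := hpos m hm; omega
  have := hpos m hm
  omega

theorem exists_fraction_pderiv_eq_zero (f : RatFun v) : ∃ p q : MvPolynomial v ℝ, q ≠ 0 ∧
    f = algebraMap _ (RatFun v) p / algebraMap _ (RatFun v) q ∧
    ∀ i, partialDer i f = 0 → i ∉ p.vars ∧ i ∉ q.vars := by
  obtain ⟨p, q, hpq, hf⟩ := IsFractionRing.exists_reduced_fraction (MvPolynomial v ℝ) f
  have hq : (q : MvPolynomial v ℝ) ≠ 0 := nonZeroDivisors.ne_zero q.2
  have hq' : algebraMap _ (RatFun v) (q : MvPolynomial v ℝ) ≠ 0 := by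
    rwa [Ne, FaithfulSMul.algebraMap_eq_zero_iff]
  have hf' : f = algebraMap _ (RatFun v) p / algebraMap _ (RatFun v) (q : MvPolynomial v ℝ) := by
    rw [← hf, IsFractionRing.mk'_eq_div]
  refine ⟨p, q, hq, hf', fun i hi => ?_⟩
  have h1 : algebraMap _ (RatFun v) p = f * algebraMap _ (RatFun v) (q : MvPolynomial v ℝ) := by
    rw [hf', div_mul_cancel₀ _ hq']
  have h2 := congrArg (partialDer i) h1
  rw [Derivation.leibniz, hi, smul_zero, add_zero, partialDer_algebraMap, partialDer_algebraMap,
    smul_eq_mul] at h2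
  have h3 : pderiv i p * q = p * pderiv i (q : MvPolynomial v ℝ) := by
    apply IsFractionRing.injective (MvPolynomial v ℝ) (RatFun v)
    rw [map_mul, map_mul, h2, h1]; ring
  have h4 : pderiv i (q : MvPolynomial v ℝ) = 0 :=
    pderiv_eq_zero_of_dvd (hpq.symm.dvd_of_dvd_mul_left (Dvd.intro_left _ h3))
  rw [h4, mul_zero] at h3
  exact ⟨notMem_vars_of_pderiv_eq_zero ((mul_eq_zero.1 h3).resolve_right hq),
    notMem_vars_of_pderiv_eq_zero h4⟩

theorem eq_const_of_partialDer_eq_zero {f : RatFun v} (h : ∀ i, partialDer i f = 0) :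
    ∃ c : ℝ, f = algebraMap ℝ (RatFun v) c := by
  obtain ⟨p, q, hq, rfl, hpq⟩ := exists_fraction_pderiv_eq_zero f
  have hp : p = C (p.coeff 0) :=
    vars_eq_empty_iff_eq_C.1 (Finset.eq_empty_of_forall_notMem fun i => (hpq i (h i)).1)
  have hq : q = C (q.coeff 0) :=
    vars_eq_empty_iff_eq_C.1 (Finset.eq_empty_of_forall_notMem fun i => (hpq i (h i)).2)
  refine ⟨p.coeff 0 / q.coeff 0, ?_⟩
  rw [map_div₀, IsScalarTower.algebraMap_apply ℝ (MvPolynomial v ℝ) (RatFun v),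
    IsScalarTower.algebraMap_apply ℝ (MvPolynomial v ℝ) (RatFun v), MvPolynomial.algebraMap_eq,
    ← hp, ← hq]

theorem baseIncl_algebraMap (p : MvPolynomial (Fin 2) ℝ) :
    baseIncl (algebraMap _ (RatFun (Fin 2)) p) =
      algebraMap (MvPolynomial IntVar ℝ) EqFun (rename Sum.inl p) :=
  IsFractionRing.lift_algebraMap baseHom_injective p

theorem baseIncl_coord (i : Fin 2) : baseIncl (coord i) = coord (Sum.inl i) := by
  rw [coord, baseIncl_algebraMap, rename_X, coord]

theorem exists_baseIncl_eq {f : EqFun} (h : ∀ s, partialDer (Sum.inr s) f = 0) :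
    ∃ g, baseIncl g = f := by
  obtain ⟨p, q, hq, rfl, hpq⟩ := exists_fraction_pderiv_eq_zero f
  have hr : ∀ r : MvPolynomial IntVar ℝ, (∀ s, Sum.inr s ∉ r.vars) →
      ∃ r', rename (Sum.inl : Fin 2 → IntVar) r' = r := by
    intro r hr
    refine exists_rename_eq_of_vars_subset_range r _ Sum.inl_injective ?_
    rintro (i | s) hi
    · exact ⟨i, rfl⟩
    · exact absurd hi (hr s)
  obtain ⟨p', hp'⟩ := hr p fun s => (hpq _ (h s)).1
  obtain ⟨q', hq'⟩ := hr q fun s => (hpq _ (h s)).2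
  refine ⟨algebraMap _ _ p' / algebraMap _ _ q', ?_⟩
  rw [map_div₀, baseIncl_algebraMap, baseIncl_algebraMap, hp', hq']

theorem derivation_baseIncl {D : Derivation ℝ EqFun EqFun}
    {d : Derivation ℝ (RatFun (Fin 2)) (RatFun (Fin 2))}
    (h : ∀ i, D (coord (Sum.inl i)) = baseIncl (d (coord i))) (g : RatFun (Fin 2)) :
    D (baseIncl g) = baseIncl (d g) := by
  have hp : ∀ p : MvPolynomial (Fin 2) ℝ,
      D (baseIncl (algebraMap _ _ p)) = baseIncl (d (algebraMap _ _ p)) := by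
    intro p
    induction p using MvPolynomial.induction_on with
    | C c =>
      rw [← MvPolynomial.algebraMap_eq,
        ← IsScalarTower.algebraMap_apply ℝ (MvPolynomial (Fin 2) ℝ) (RatFun (Fin 2)),
        AlgHom.commutes, Derivation.map_algebraMap, Derivation.map_algebraMap, map_zero]
    | add p q hp hq => simp only [map_add, hp, hq]
    | mul_X p i hp =>
      have hi : D (baseIncl (algebraMap (MvPolynomial (Fin 2) ℝ) _ (X i))) =
          baseIncl (d (algebraMap (MvPolynomial (Fin 2) ℝ) _ (X i))) := by
        change D (baseIncl (coord i)) = baseIncl (d (coord i))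
        rw [baseIncl_coord, h]
      simp only [map_mul, Derivation.leibniz, hp, hi, smul_eq_mul, map_add]
  obtain ⟨p, q, -, rfl⟩ := IsFractionRing.div_surjective (A := MvPolynomial (Fin 2) ℝ) g
  simp only [map_div₀, Derivation.leibniz_div, hp, map_mul, map_sub, smul_eq_mul, map_inv₀, map_pow]

theorem derivation_baseIncl_eq_zero {D : Derivation ℝ EqFun EqFun}
    (h : ∀ i, D (coord (Sum.inl i)) = 0) (g : RatFun (Fin 2)) : D (baseIncl g) = 0 := by
  rw [derivation_baseIncl (d := 0) (by simpa using h)]; simp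

end PartialDerivatives

section VerticalDerivations

/-- The function `x + y` on `𝓔^∞`. -/
def wE : EqFun := coord (Sum.inl 0) + coord (Sum.inl 1)

theorem wE_ne_zero : wE ≠ 0 := by
  intro h
  have h1 := congrArg (partialDer (Sum.inl 0)) h
  rw [wE, map_add, partialDer_coord_self, partialDer_coord_of_ne (by simp)] at h1
  simp at h1

theorem isFrame_eq : IsFrame (coord (Sum.inl 0) : EqFun) (coord (Sum.inl 1)) DxE DyE where
  d₁x := by simp [DxE, fracDer_coord]
  d₁y := by simp [DxE, fracDer_coord]
  d₂x := by simp [DyE, fracDer_coord]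
  d₂y := by simp [DyE, fracDer_coord]
  comm := DxE_DyE

theorem DxE_wE : DxE wE = 1 := by rw [wE, map_add, isFrame_eq.d₁x, isFrame_eq.d₁y, add_zero]

theorem DyE_wE : DyE wE = 1 := by rw [wE, map_add, isFrame_eq.d₂x, isFrame_eq.d₂y, zero_add]

theorem derivation_inv_pow (D : Derivation ℝ EqFun EqFun) (n : ℕ) :
    D (wE⁻¹ ^ n) = -(n : EqFun) * wE⁻¹ ^ (n + 1) * D wE := by
  rw [Derivation.leibniz_pow, Derivation.leibniz_inv]
  rcases n with _ | n
  · simp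
  · simp only [nsmul_eq_mul, smul_eq_mul, Nat.add_sub_cancel, neg_mul]
    rw [pow_succ _ (n + 1), pow_succ _ n]
    ring

/-- The derivation which kills `x` and `y` and takes the jet variable with index `(i, j)` to
`α i j / (x + y) ^ (i + j)`. -/
def vert (α : Fin 2 → ℕ → ℝ) : Derivation ℝ EqFun EqFun :=
  fracDer (Sum.elim (fun _ => 0) fun s => α s.1 s.2 • wE⁻¹ ^ (s.1.val + s.2))

theorem vert_inl (α : Fin 2 → ℕ → ℝ) (i : Fin 2) : vert α (coord (Sum.inl i)) = 0 := by
  simp [vert, fracDer_coord]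

theorem vert_inr (α : Fin 2 → ℕ → ℝ) (i : Fin 2) (j : ℕ) :
    vert α (coord (Sum.inr (i, j))) = α i j • wE⁻¹ ^ (i.val + j) := by
  simp [vert, fracDer_coord]

theorem vert_wE (α : Fin 2 → ℕ → ℝ) : vert α wE = 0 := by
  rw [wE, map_add, vert_inl, vert_inl, add_zero]

theorem vert_inv_pow (α : Fin 2 → ℕ → ℝ) (n : ℕ) : vert α (wE⁻¹ ^ n) = 0 := by
  rw [derivation_inv_pow, vert_wE, mul_zero]

theorem vert_add (α β : Fin 2 → ℕ → ℝ) : vert (α + β) = vert α + vert β := by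
  apply fracDer_ext
  rintro (i | ⟨i, j⟩)
  · simp [vert_inl]
  · simp [vert_inr, add_smul]

theorem vert_smul (c : ℝ) (α : Fin 2 → ℕ → ℝ) : vert (c • α) = c • vert α := by
  apply fracDer_ext
  rintro (i | ⟨i, j⟩)
  · simp [vert_inl]
  · simp [vert_inr, smul_smul]

section Shift

variable {R : Type} [CommRing R]

/-- The effect on coefficients of the commutator with `D_y`. -/
def shiftY (α : Fin 2 → ℕ → R) : Fin 2 → ℕ → R :=
  fun i j => α i (j + 1) + (i.val + j : ℕ) * α i j

/-- The coefficient of the derivative along `α` of the restriction of `u_{xx,jy}`. -/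
def uxxCoeff : ℕ → (Fin 2 → ℕ → R) → R
  | 0, α => -α 0 2 - α 1 0 - α 0 1
  | j + 1, α => uxxCoeff j (shiftY α) - (j + 2 : ℕ) * uxxCoeff j α

/-- The effect on coefficients of the commutator with `D_x`. -/
def shiftX (α : Fin 2 → ℕ → R) : Fin 2 → ℕ → R :=
  fun i j => (if i = 0 then α 1 j else uxxCoeff j α) + (i.val + j : ℕ) * α i j

theorem shiftY_add (α β : Fin 2 → ℕ → R) : shiftY (α + β) = shiftY α + shiftY β := by
  funext i j; simp only [shiftY, Pi.add_apply]; ring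

theorem shiftY_smul (c : R) (α : Fin 2 → ℕ → R) : shiftY (c • α) = c • shiftY α := by
  funext i j; simp only [shiftY, Pi.smul_apply, smul_eq_mul]; ring

theorem uxxCoeff_add (j : ℕ) (α β : Fin 2 → ℕ → R) :
    uxxCoeff j (α + β) = uxxCoeff j α + uxxCoeff j β := by
  induction j generalizing α β with
  | zero => simp only [uxxCoeff, Pi.add_apply]; ring
  | succ j ih => simp only [uxxCoeff, shiftY_add, ih]; ring

theorem uxxCoeff_smul (j : ℕ) (c : R) (α : Fin 2 → ℕ → R) :
    uxxCoeff j (c • α) = c * uxxCoeff j α := by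
  induction j generalizing α with
  | zero => simp only [uxxCoeff, Pi.smul_apply, smul_eq_mul]; ring
  | succ j ih => simp only [uxxCoeff, shiftY_smul, ih]; ring

end Shift

theorem natCast_mul_smul (n : ℕ) (a : ℝ) (f : EqFun) :
    ((n : ℝ) * a) • f = (n : EqFun) * (a • f) := by
  rw [mul_smul, Algebra.smul_def, map_natCast]

theorem vert_DyE (α : Fin 2 → ℕ → ℝ) (f : EqFun) :
    vert α (DyE f) = DyE (vert α f) + wE⁻¹ * vert (shiftY α) f := by
  have h : ⁅vert α, DyE⁆ = wE⁻¹ • vert (shiftY α) := by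
    apply fracDer_ext
    rintro (i | ⟨i, j⟩)
    · rw [Derivation.commutator_apply, vert_inl, Derivation.smul_apply, vert_inl]
      fin_cases i <;> simp [DyE, fracDer_coord]
    · rw [Derivation.commutator_apply, vert_inr, Derivation.smul_apply, vert_inr,
        Derivation.map_smul, derivation_inv_pow, DyE_wE]
      have : DyE (coord (Sum.inr (i, j))) = coord (Sum.inr (i, j + 1)) := by
        simp [DyE, fracDer_coord]
      rw [this, vert_inr, shiftY, add_smul, natCast_mul_smul, ← add_assoc, pow_succ]
      simp only [Algebra.smul_def (R := ℝ), smul_eq_mul]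
      ring
  have := congrArg (fun D => D f) h
  simp only [Derivation.commutator_apply, Derivation.smul_apply, smul_eq_mul] at this
  linear_combination this

theorem vert_uxxE (α : Fin 2 → ℕ → ℝ) (j : ℕ) :
    vert α (DyE^[j] uxxE) = uxxCoeff j α • wE⁻¹ ^ (j + 2) := by
  induction j generalizing α with
  | zero =>
    have h : uxxE = -coord (Sum.inr (0, 2)) -
        (coord (Sum.inr (1, 0)) + coord (Sum.inr (0, 1))) * wE⁻¹ ^ 1 := by
      rw [uxxE, wE, pow_one, div_eq_mul_inv]
    rw [Function.iterate_zero, id_eq, h, map_sub, map_neg, Derivation.leibniz, vert_inv_pow,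
      map_add,
      vert_inr, vert_inr, vert_inr, uxxCoeff]
    simp only [Algebra.smul_def (R := ℝ), smul_eq_mul, map_sub, map_neg, Fin.val_zero, Fin.val_one]
    ring
  | succ j ih =>
    rw [Function.iterate_succ_apply', vert_DyE, ih, ih, Derivation.map_smul, derivation_inv_pow,
      DyE_wE, uxxCoeff, sub_smul, natCast_mul_smul]
    simp only [Algebra.smul_def]
    ring

theorem vert_DxE (α : Fin 2 → ℕ → ℝ) (f : EqFun) :
    vert α (DxE f) = DxE (vert α f) + wE⁻¹ * vert (shiftX α) f := by
  have h : ⁅vert α, DxE⁆ = wE⁻¹ • vert (shiftX α) := by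
    apply fracDer_ext
    rintro (i | ⟨i, j⟩)
    · rw [Derivation.commutator_apply, vert_inl, Derivation.smul_apply, vert_inl]
      fin_cases i <;> simp [DxE, fracDer_coord]
    · rw [Derivation.commutator_apply, vert_inr, Derivation.smul_apply, vert_inr,
        Derivation.map_smul, derivation_inv_pow, DxE_wE]
      have : vert α (DxE (coord (Sum.inr (i, j)))) =
          (if i = 0 then α 1 j else uxxCoeff j α) • wE⁻¹ ^ (i.val + j + 1) := by
        fin_cases i
        · simp [DxE, fracDer_coord, vert_inr, add_comm]
        · simp only [DxE, fracDer_coord, Sum.elim_inr, Fin.mk_one, one_ne_zero, if_false, vert_uxxE]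
          rw [show 1 + j + 1 = j + 2 by ring]
      rw [this, shiftX, add_smul, natCast_mul_smul, pow_succ]
      simp only [Algebra.smul_def (R := ℝ), smul_eq_mul]
      ring
  have := congrArg (fun D => D f) h
  simp only [Derivation.commutator_apply, Derivation.smul_apply, smul_eq_mul] at this
  linear_combination this

end VerticalDerivations

section Coefficients

open Complex

/-- The effect of `(x + y) D_y` on the components of a linear differential operator whose
coefficients are multiples of `(x + y) ^ (-n)`. -/
def stepY (n : ℕ) (c : ℤ → ℂ) : ℤ → ℂ := fun k =>
  -n * c k + 1 / 2 * (((k : ℂ) - 1 / 2) * (1 - I) * c (k - 1) + (-1 + 2 * I * k) * c k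
    - ((k : ℂ) + 1 / 2) * (1 + I) * c (k + 1))

/-- The effect of `(x + y) D_x` on the components of a linear differential operator whose
coefficients are multiples of `(x + y) ^ (-n)`. -/
def stepX (n : ℕ) (c : ℤ → ℂ) : ℤ → ℂ := fun k =>
  -n * c k + 1 / 2 * (((k : ℂ) - 1 / 2) * (1 + I) * c (k - 1) + (-1 - 2 * I * k) * c k
    - ((k : ℂ) + 1 / 2) * (1 - I) * c (k + 1))

theorem stepX_stepY (n : ℕ) (c : ℤ → ℂ) :
    stepX (n + 1) (stepY n c) = stepY (n + 1) (stepX n c) := by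
  funext k
  simp only [stepX, stepY, sub_add_cancel, add_sub_cancel_right]
  push_cast
  ring

/-- The components of `u_{jy}`. -/
def componentsY : ℕ → ℤ → ℂ
  | 0 => Pi.single 0 1
  | j + 1 => stepY j (componentsY j)

/-- The components of `u_{ix,jy}`, `i ≤ 1`. -/
def components (i : Fin 2) (j : ℕ) : ℤ → ℂ :=
  if i = 0 then componentsY j else stepX j (componentsY j)

theorem components_succ (i : Fin 2) (j : ℕ) :
    components i (j + 1) = stepY (i.val + j) (components i j) := by
  fin_cases i
  · simp [components, componentsY]
  · simp [components, componentsY, stepX_stepY, add_comm]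

theorem stepX_stepX_add (c : ℤ → ℂ) (k : ℤ) :
    stepX 1 (stepX 0 c) k + stepY 1 (stepY 0 c) k + stepX 0 c k + stepY 0 c k =
      2 * (-2 * k ^ 2 * c k + (k + 1 / 2) * (k + 1) * c (k + 1)
        + (k - 1 / 2) * (k - 1) * c (k - 1)) := by
  simp only [stepX, stepY, sub_add_cancel, add_sub_cancel_right]
  push_cast
  linear_combination (c k / 4 + 3 * k ^ 2 * c k + 2 * k * c (k - 1) - 2 * k * c (k + 1)
    - k * c (k - 1 - 1) + k * c (k + 1 + 1) - 2 * k ^ 2 * c (k - 1) - 2 * k ^ 2 * c (k + 1)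
    + k ^ 2 * c (k - 1 - 1) / 2 + k ^ 2 * c (k + 1 + 1) / 2 - c (k - 1) / 2 - c (k + 1) / 2
    + 3 / 8 * c (k - 1 - 1) + 3 / 8 * c (k + 1 + 1)) * I_sq

/-- The coefficients of the `k`-th vertical derivation. -/
def coeffs (k : ℤ) : Fin 2 → ℕ → ℂ := fun i j => components i j k

theorem shiftY_coeffs (k : ℤ) : shiftY (coeffs k) =
    (1 / 2 * (((k : ℂ) - 1 / 2) * (1 - I))) • coeffs (k - 1) +
    (1 / 2 * (-1 + 2 * I * k)) • coeffs k +
    (-(1 / 2) * (((k : ℂ) + 1 / 2) * (1 + I))) • coeffs (k + 1) := by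
  funext i j
  simp only [shiftY, coeffs, components_succ, stepY, Pi.add_apply, Pi.smul_apply, smul_eq_mul]
  ring

theorem uxxCoeff_coeffs (j : ℕ) (k : ℤ) :
    uxxCoeff j (coeffs k) = stepX (j + 1) (components 1 j) k := by
  induction j generalizing k with
  | zero =>
    have h := stepX_stepX_add (componentsY 0) k
    have h0 : 2 * (-2 * k ^ 2 * componentsY 0 k + (k + 1 / 2) * (k + 1) * componentsY 0 (k + 1)
        + (k - 1 / 2) * (k - 1) * componentsY 0 (k - 1)) = 0 := by
      simp only [componentsY, Pi.single_apply]
      by_cases h1 : k = 0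
      · subst h1; norm_num
      by_cases h2 : k + 1 = 0
      · obtain rfl : k = -1 := by omega
        norm_num
      by_cases h3 : k - 1 = 0
      · obtain rfl : k = 1 := by omega
        norm_num
      simp [h1, h2, h3]
    rw [h0] at h
    simp only [uxxCoeff, coeffs, components, componentsY, if_true, one_ne_zero, if_false] at h ⊢
    linear_combination -h
  | succ j ih =>
    rw [uxxCoeff, shiftY_coeffs, uxxCoeff_add, uxxCoeff_add, uxxCoeff_smul, uxxCoeff_smul,
      uxxCoeff_smul, ih, ih, ih, components_succ, Fin.val_one, add_comm 1 j, stepX_stepY]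
    simp only [stepY]
    push_cast
    ring

theorem shiftX_coeffs (k : ℤ) : shiftX (coeffs k) =
    (1 / 2 * (((k : ℂ) - 1 / 2) * (1 + I))) • coeffs (k - 1) +
    (1 / 2 * (-1 - 2 * I * k)) • coeffs k +
    (-(1 / 2) * (((k : ℂ) + 1 / 2) * (1 - I))) • coeffs (k + 1) := by
  funext i j
  simp only [shiftX, uxxCoeff_coeffs, Pi.add_apply, Pi.smul_apply, smul_eq_mul]
  fin_cases i
  · simp only [Fin.zero_eta, if_true, coeffs, components, one_ne_zero, if_false, stepX,
      zero_add]
    ring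
  · simp only [Fin.mk_one, one_ne_zero, if_false, coeffs, stepX]
    push_cast
    ring

theorem componentsY_neg (j : ℕ) (k : ℤ) :
    componentsY j (-k) = (starRingEnd ℂ) (componentsY j k) := by
  induction j generalizing k with
  | zero =>
    by_cases h : k = 0
    · subst h; simp [componentsY]
    · simp [componentsY, h]
  | succ j ih =>
    simp only [componentsY, stepY]
    rw [show -k - 1 = -(k + 1) by ring, show -k + 1 = -(k - 1) by ring, ih, ih, ih]
    simp only [map_add, map_sub, map_mul, map_neg, map_natCast, map_intCast, map_one, conj_I,
      map_div₀, map_ofNat]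
    push_cast
    ring

theorem coeffs_neg (k : ℤ) (i : Fin 2) (j : ℕ) :
    coeffs (-k) i j = (starRingEnd ℂ) (coeffs k i j) := by
  fin_cases i
  · simpa [coeffs, components] using componentsY_neg j k
  · simp only [coeffs, components, Fin.mk_one, one_ne_zero, if_false, stepX]
    rw [show -k - 1 = -(k + 1) by ring, show -k + 1 = -(k - 1) by ring, componentsY_neg,
      componentsY_neg, componentsY_neg]
    simp only [map_add, map_sub, map_mul, map_neg, map_natCast, map_intCast, map_one, conj_I,
      map_div₀, map_ofNat]
    push_cast
    ring

theorem componentsY_eq_zero (j : ℕ) (k : ℤ) (h : (j : ℤ) < |k|) : componentsY j k = 0 := by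
  induction j generalizing k with
  | zero =>
    have : k ≠ 0 := by rintro rfl; simp at h
    simp [componentsY, this]
  | succ j ih =>
    rw [lt_abs] at h
    push_cast at h
    simp only [componentsY, stepY]
    rw [ih k (by rw [lt_abs]; omega), ih (k - 1) (by rw [lt_abs]; omega),
      ih (k + 1) (by rw [lt_abs]; omega)]
    ring

theorem coeffs_eq_zero (i : Fin 2) (j : ℕ) (k : ℤ) (h : (i.val + j : ℤ) < |k|) :
    coeffs k i j = 0 := by
  rw [lt_abs] at h
  fin_cases i
  · simp at h
    simpa [coeffs, components] using componentsY_eq_zero j k (by rw [lt_abs]; omega)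
  · simp at h
    simp only [coeffs, components, Fin.mk_one, one_ne_zero, if_false, stepX]
    rw [componentsY_eq_zero j k (by rw [lt_abs]; omega),
      componentsY_eq_zero j (k - 1) (by rw [lt_abs]; omega),
      componentsY_eq_zero j (k + 1) (by rw [lt_abs]; omega)]
    ring

theorem componentsY_succ_top (j : ℕ) : componentsY (j + 1) (j + 1) =
    1 / 2 * ((j + 1 / 2) * (1 - I)) * componentsY j j := by
  simp only [componentsY, stepY]
  rw [componentsY_eq_zero j (j + 1) (by rw [lt_abs]; omega),
    componentsY_eq_zero j (j + 1 + 1) (by rw [lt_abs]; omega), add_sub_cancel_right]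
  push_cast
  ring

theorem componentsY_top_ne_zero (j : ℕ) : componentsY j j ≠ 0 := by
  induction j with
  | zero => simp [componentsY]
  | succ j ih =>
    push_cast
    rw [componentsY_succ_top]
    have h1 : (j : ℂ) + 1 / 2 ≠ 0 := by simpa using int_add_half_ne_zero j
    have h2 : 1 - I ≠ 0 := by
      intro h
      have := congrArg re h
      simp at this
    exact mul_ne_zero (mul_ne_zero (by norm_num) (mul_ne_zero h1 h2)) ih

theorem coeffs_one_top (j : ℕ) : coeffs (j + 1) 1 j = I * coeffs (j + 1) 0 (j + 1) := by
  simp only [coeffs, components, if_true, one_ne_zero, if_false]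
  rw [componentsY_succ_top]
  simp only [stepX]
  rw [componentsY_eq_zero j (j + 1) (by rw [lt_abs]; omega),
    componentsY_eq_zero j (j + 1 + 1) (by rw [lt_abs]; omega), add_sub_cancel_right]
  push_cast
  linear_combination (1 / 2 * (j + 1 / 2) * componentsY j j) * I_sq

end Coefficients

section Complexification

open Complex TensorProduct

/-- Complex-valued rational functions on `𝓔^∞`. -/
abbrev CEqFun : Type := ℂ ⊗[ℝ] EqFun

/-- The complexification of an operator. -/
def cOp (T : Module.End ℝ EqFun) : Module.End ℂ CEqFun := T.baseChange ℂ

/-- A real function, as a complex-valued function. -/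
def cIncl : EqFun →ₗ[ℝ] CEqFun := TensorProduct.mk ℝ ℂ EqFun 1

theorem cOp_cIncl (T : Module.End ℝ EqFun) (f : EqFun) : cOp T (cIncl f) = cIncl (T f) := rfl

theorem tmul_eq_smul_cIncl (c : ℂ) (f : EqFun) : c ⊗ₜ[ℝ] f = c • cIncl f := by
  simp [cIncl, TensorProduct.smul_tmul']

theorem cEqFun_end_ext {P Q : Module.End ℂ CEqFun} (h : ∀ f, P (cIncl f) = Q (cIncl f)) :
    P = Q := by
  ext f
  exact h f

theorem cIncl_smul (c : ℝ) (f : EqFun) : cIncl (c • f) = (c : ℂ) • cIncl f := by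
  rw [map_smul]; rfl

theorem exists_cIncl_add (f : CEqFun) : ∃ a b, f = cIncl a + I • cIncl b := by
  induction f using TensorProduct.induction_on with
  | zero => exact ⟨0, 0, by simp⟩
  | tmul c a =>
    refine ⟨c.re • a, c.im • a, ?_⟩
    rw [tmul_eq_smul_cIncl, cIncl_smul, cIncl_smul, smul_smul, ← add_smul]
    congr 1
    rw [mul_comm]; exact (re_add_im c).symm
  | add f g hf hg =>
    obtain ⟨a, b, rfl⟩ := hf
    obtain ⟨a', b', rfl⟩ := hg
    exact ⟨a + a', b + b', by simp only [map_add, smul_add]; abel⟩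

/-- The real part. -/
def cRe : CEqFun →ₗ[ℝ] EqFun :=
  (TensorProduct.lid ℝ EqFun).toLinearMap ∘ₗ LinearMap.rTensor EqFun reLm

theorem cRe_smul_cIncl (c : ℂ) (f : EqFun) : cRe (c • cIncl f) = c.re • f := by
  rw [← tmul_eq_smul_cIncl]
  simp [cRe]

theorem cRe_cIncl (f : EqFun) : cRe (cIncl f) = f := by
  simpa using cRe_smul_cIncl 1 f

theorem cIncl_add_eq_zero {a b : EqFun} (h : cIncl a + I • cIncl b = 0) : a = 0 ∧ b = 0 := by
  have h1 := congrArg cRe h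
  have h2 := congrArg (fun f => cRe (I • f)) h
  simp only [smul_add, smul_smul, map_add, cRe_smul_cIncl, cRe_cIncl, I_mul_I, map_zero, smul_zero,
    I_re, zero_smul, neg_smul, one_smul, add_zero, zero_add, map_neg, neg_eq_zero] at h1 h2
  exact ⟨h1, h2⟩

/-- The complex combination of vertical derivations with coefficients `α`. -/
def vertC (α : Fin 2 → ℕ → ℂ) : Module.End ℂ CEqFun :=
  cOp (vert fun i j => (α i j).re : EqFun →ₗ[ℝ] EqFun) +
    I • cOp (vert fun i j => (α i j).im : EqFun →ₗ[ℝ] EqFun)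

theorem vertC_cIncl (α : Fin 2 → ℕ → ℂ) (f : EqFun) :
    vertC α (cIncl f) =
      cIncl (vert (fun i j => (α i j).re) f) + I • cIncl (vert (fun i j => (α i j).im) f) := rfl

theorem vertC_add (α β : Fin 2 → ℕ → ℂ) : vertC (α + β) = vertC α + vertC β := by
  apply cEqFun_end_ext
  intro f
  have h1 : (fun i j => ((α + β) i j).re) = (fun i j => (α i j).re) + fun i j => (β i j).re := rfl
  have h2 : (fun i j => ((α + β) i j).im) = (fun i j => (α i j).im) + fun i j => (β i j).im := rfl
  rw [LinearMap.add_apply, vertC_cIncl, vertC_cIncl, vertC_cIncl, h1, h2, vert_add, vert_add]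
  simp only [Derivation.add_apply, map_add, smul_add]
  abel

theorem vertC_smul (c : ℂ) (α : Fin 2 → ℕ → ℂ) : vertC (c • α) = c • vertC α := by
  apply cEqFun_end_ext
  intro f
  have h1 : (fun i j => ((c • α) i j).re) =
      c.re • (fun i j => (α i j).re) + (-c.im) • fun i j => (α i j).im := by
    funext i j; simp; ring
  have h2 : (fun i j => ((c • α) i j).im) =
      c.re • (fun i j => (α i j).im) + c.im • fun i j => (α i j).re := by
    funext i j; simp
  rw [LinearMap.smul_apply, vertC_cIncl, vertC_cIncl, h1, h2, vert_add, vert_add, vert_smul,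
    vert_smul, vert_smul, vert_smul]
  simp only [Derivation.add_apply, Derivation.smul_apply, map_add, cIncl_smul]
  conv_rhs => rw [← re_add_im c]
  push_cast
  match_scalars
  · ring
  · linear_combination (-(c.im : ℂ)) * I_sq

/-- Multiplication by a function. -/
def cMul (a : EqFun) : Module.End ℂ CEqFun := cOp (LinearMap.mulLeft ℝ a)

theorem cMul_cIncl (a f : EqFun) : cMul a (cIncl f) = cIncl (a * f) := rfl

/-- `(x + y) D_x`. -/
def opX : Module.End ℂ CEqFun := cMul wE * cOp (DxE : EqFun →ₗ[ℝ] EqFun)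

/-- `(x + y) D_y`. -/
def opY : Module.End ℂ CEqFun := cMul wE * cOp (DyE : EqFun →ₗ[ℝ] EqFun)

theorem opX_cIncl (f : EqFun) : opX (cIncl f) = cIncl (wE * DxE f) := rfl

theorem opY_cIncl (f : EqFun) : opY (cIncl f) = cIncl (wE * DyE f) := rfl

theorem opX_opY (f : CEqFun) : opX (opY f) = opY (opX f) + opY f - opX f := by
  have h : opX * opY = opY * opX + opY - opX := by
    apply cEqFun_end_ext
    intro f
    simp only [LinearMap.add_apply, LinearMap.sub_apply, Module.End.mul_apply, opX_cIncl, opY_cIncl,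
      ← map_add, ← map_sub]
    congr 1
    simp only [Derivation.leibniz, smul_eq_mul, DxE_wE, DyE_wE, DxE_DyE]
    ring
  exact congrArg (fun P => P f) h

theorem vertC_opX (α : Fin 2 → ℕ → ℂ) (f : CEqFun) :
    vertC α (opX f) = opX (vertC α f) + vertC (shiftX α) f := by
  have h1 : (fun i j => (shiftX α i j).re) = shiftX fun i j => (α i j).re := by
    have hY : ∀ β : Fin 2 → ℕ → ℂ,
        (fun i j => (shiftY β i j).re) = shiftY fun i j => (β i j).re := by
      intro β; funext i j; simp [shiftY]
    have hU : ∀ (j : ℕ) (β : Fin 2 → ℕ → ℂ),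
        (uxxCoeff j β).re = uxxCoeff j fun i j => (β i j).re := by
      intro j
      induction j with
      | zero => intro β; simp [uxxCoeff]
      | succ j ih => intro β; rw [uxxCoeff, uxxCoeff, ← hY, ← ih, ← ih]; simp
    funext i j
    fin_cases i <;> simp [shiftX, hU]
  have h2 : (fun i j => (shiftX α i j).im) = shiftX fun i j => (α i j).im := by
    have hY : ∀ β : Fin 2 → ℕ → ℂ,
        (fun i j => (shiftY β i j).im) = shiftY fun i j => (β i j).im := by
      intro β; funext i j; simp [shiftY]
    have hU : ∀ (j : ℕ) (β : Fin 2 → ℕ → ℂ),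
        (uxxCoeff j β).im = uxxCoeff j fun i j => (β i j).im := by
      intro j
      induction j with
      | zero => intro β; simp [uxxCoeff]
      | succ j ih => intro β; rw [uxxCoeff, uxxCoeff, ← hY, ← ih, ← ih]; simp
    funext i j
    fin_cases i <;> simp [shiftX, hU]
  have hr : ∀ (a : Fin 2 → ℕ → ℝ) (f : EqFun),
      vert a (wE * DxE f) = wE * DxE (vert a f) + vert (shiftX a) f := by
    intro a f
    rw [Derivation.leibniz, vert_wE, vert_DxE]
    simp only [smul_eq_mul, mul_zero, add_zero, mul_add, mul_inv_cancel_left₀ wE_ne_zero]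
  have h : vertC α * opX = opX * vertC α + vertC (shiftX α) := by
    apply cEqFun_end_ext
    intro f
    simp only [LinearMap.add_apply, Module.End.mul_apply, opX_cIncl, vertC_cIncl, hr, map_add,
      map_smul, smul_add, h1, h2]
    abel
  exact congrArg (fun P => P f) h

theorem vertC_opY (α : Fin 2 → ℕ → ℂ) (f : CEqFun) :
    vertC α (opY f) = opY (vertC α f) + vertC (shiftY α) f := by
  have h1 : (fun i j => (shiftY α i j).re) = shiftY fun i j => (α i j).re := by
    funext i j; simp [shiftY]
  have h2 : (fun i j => (shiftY α i j).im) = shiftY fun i j => (α i j).im := by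
    funext i j; simp [shiftY]
  have hr : ∀ (a : Fin 2 → ℕ → ℝ) (f : EqFun),
      vert a (wE * DyE f) = wE * DyE (vert a f) + vert (shiftY a) f := by
    intro a f
    rw [Derivation.leibniz, vert_wE, vert_DyE]
    simp only [smul_eq_mul, mul_zero, add_zero, mul_add, mul_inv_cancel_left₀ wE_ne_zero]
  have h : vertC α * opY = opY * vertC α + vertC (shiftY α) := by
    apply cEqFun_end_ext
    intro f
    simp only [LinearMap.add_apply, Module.End.mul_apply, opY_cIncl, vertC_cIncl, hr, map_add,
      map_smul, smul_add, h1, h2]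
    abel
  exact congrArg (fun P => P f) h

/-- The vertical derivations dual to a frame in which the total derivatives are tridiagonal. -/
def vertE (k : ℤ) : Module.End ℂ CEqFun := vertC (coeffs k)

theorem vertE_opX (k : ℤ) (f : CEqFun) : vertE k (opX f) = opX (vertE k f) +
    (1 / 2 * (((k : ℂ) - 1 / 2) * (1 + I))) • vertE (k - 1) f +
    (1 / 2 * (-1 - 2 * I * k)) • vertE k f +
    (-(1 / 2) * (((k : ℂ) + 1 / 2) * (1 - I))) • vertE (k + 1) f := by
  simp only [vertE]
  rw [vertC_opX, shiftX_coeffs]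
  simp only [vertC_add, vertC_smul, LinearMap.add_apply, LinearMap.smul_apply]
  abel

theorem vertE_opY (k : ℤ) (f : CEqFun) : vertE k (opY f) = opY (vertE k f) +
    (1 / 2 * (((k : ℂ) - 1 / 2) * (1 - I))) • vertE (k - 1) f +
    (1 / 2 * (-1 + 2 * I * k)) • vertE k f +
    (-(1 / 2) * (((k : ℂ) + 1 / 2) * (1 + I))) • vertE (k + 1) f := by
  simp only [vertE]
  rw [vertC_opY, shiftY_coeffs]
  simp only [vertC_add, vertC_smul, LinearMap.add_apply, LinearMap.smul_apply]
  abel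

/-- The Euler operator along one of the two complex characteristics. -/
def thetaE : Module.End ℂ CEqFun := ((1 - I) / 2) • opX + ((1 + I) / 2) • opY

/-- A multiple of `(x + y)(D_x - D_y)`. -/
def omegaE : Module.End ℂ CEqFun := I • (opX - opY)

theorem vert_coeffs_eq_zero (f : EqFun) : ∃ N : ℕ, ∀ k : ℤ, (N : ℤ) < |k| →
    vert (fun i j => (coeffs k i j).re) f = 0 ∧ vert (fun i j => (coeffs k i j).im) f = 0 := by
  obtain ⟨N, hN⟩ : ∃ N : ℕ, ∀ i j, partialDer (Sum.inr (i, j)) f ≠ 0 → i.val + j ≤ N := by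
    refine ⟨(finite_partialDer_ne_zero f).toFinset.sup
      (Sum.elim (fun _ => 0) fun s => s.1.val + s.2), fun i j hij => ?_⟩
    exact Finset.le_sup (f := Sum.elim (fun _ => 0) fun s : Fin 2 × ℕ => s.1.val + s.2)
      ((finite_partialDer_ne_zero f).mem_toFinset.2 hij)
  refine ⟨N, fun k hk => ⟨?_, ?_⟩⟩ <;>
  · rw [← Derivation.zero_apply (R := ℝ) (A := EqFun) f]
    refine derivation_congr ?_
    rintro (i | ⟨i, j⟩) hij
    · rw [vert_inl]; rfl
    · rw [vert_inr, coeffs_eq_zero i j k (by have := hN i j hij; omega)]; simp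

theorem isLadder : IsLadder thetaE omegaE vertE where
  theta_omega f := by
    simp only [thetaE, omegaE, LinearMap.add_apply, LinearMap.sub_apply, LinearMap.smul_apply,
      map_add, map_sub, map_smul, opX_opY]
    match_scalars <;> ring
  E_theta k f := by
    simp only [thetaE, LinearMap.add_apply, LinearMap.smul_apply, map_add, map_smul, vertE_opX,
      vertE_opY]
    match_scalars
    · ring
    · linear_combination (-(1 / 2) * ((k : ℂ) - 1 / 2)) * I_sq
    · linear_combination (k : ℂ) * I_sq
    · linear_combination (-(1 / 2) * ((k : ℂ) + 1 / 2)) * I_sq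
    · ring
  E_omega k f := by
    simp only [omegaE, LinearMap.sub_apply, LinearMap.smul_apply, map_sub, map_smul, vertE_opX,
      vertE_opY]
    match_scalars
    · ring
    · linear_combination ((k : ℂ) - 1 / 2) * I_sq
    · linear_combination (-2 * (k : ℂ)) * I_sq
    · linear_combination ((k : ℂ) + 1 / 2) * I_sq
    · ring
  finite f := by
    obtain ⟨a, b, rfl⟩ := exists_cIncl_add f
    obtain ⟨N₁, h₁⟩ := vert_coeffs_eq_zero a
    obtain ⟨N₂, h₂⟩ := vert_coeffs_eq_zero b
    refine ⟨N₁ + N₂, fun k hk => ?_⟩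
    push_cast at hk
    obtain ⟨a1, a2⟩ := h₁ k (by omega)
    obtain ⟨b1, b2⟩ := h₂ k (by omega)
    rw [map_add, map_smul, vertE, vertC_cIncl, vertC_cIncl, a1, a2, b1, b2]
    simp

theorem theta_eq_iff (f : CEqFun) :
    thetaE (thetaE f) + omegaE (thetaE f) + (1 / 2 : ℂ) • omegaE f =
      (1 / 2 : ℂ) • (opX (opX f) + opY (opY f)) := by
  simp only [thetaE, omegaE, LinearMap.add_apply, LinearMap.sub_apply, LinearMap.smul_apply,
    map_add, map_smul, opX_opY]
  match_scalars
  · linear_combination (-1 / 4 : ℂ) * I_sq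
  · linear_combination (1 / 2 : ℂ) * I_sq
  · linear_combination (1 / 4 : ℂ) * I_sq
  · linear_combination (-1 / 4 : ℂ) * I_sq
  · linear_combination (-1 / 4 : ℂ) * I_sq

end Complexification

section Completeness

open Complex

theorem partialDer_eq_zero_of_vert {a : EqFun}
    (h : ∀ k : ℤ, vert (fun i j => (coeffs k i j).re) a = 0 ∧
      vert (fun i j => (coeffs k i j).im) a = 0) (s : Fin 2 × ℕ) :
    partialDer (Sum.inr s) a = 0 := by
  suffices ∀ N : ℕ, ∀ i j, N ≤ (i : Fin 2).val + j → partialDer (Sum.inr (i, j)) a = 0 by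
    exact this 0 s.1 s.2 (Nat.zero_le _)
  obtain ⟨M, hM⟩ : ∃ M : ℕ, ∀ i j, M ≤ (i : Fin 2).val + j → partialDer (Sum.inr (i, j)) a = 0 := by
    refine ⟨(finite_partialDer_ne_zero a).toFinset.sup
      (Sum.elim (fun _ => 0) fun s => s.1.val + s.2) + 1, fun i j hij => ?_⟩
    by_contra hne
    have := Finset.le_sup (f := Sum.elim (fun _ => 0) fun s : Fin 2 × ℕ => s.1.val + s.2)
      ((finite_partialDer_ne_zero a).mem_toFinset.2 hne)
    simp only [Sum.elim_inr] at this
    omega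
  intro N
  refine Nat.decreasingInduction' (m := min N M) (n := M) (P := fun N => ∀ i j,
    N ≤ (i : Fin 2).val + j → partialDer (Sum.inr (i, j)) a = 0) ?_ (min_le_right _ _) hM
    |> fun h i j hij =>
      h i j (le_trans (min_le_left _ _) hij)
  intro N _ _ ih
  have hlow : ∀ i j, partialDer (Sum.inr (i, j)) a ≠ 0 → (i : Fin 2).val + j ≤ N := by
    intro i j hij
    by_contra hlt
    exact hij (ih i j (by omega))
  intro i j hij
  by_contra hne
  have hN := hlow i j hne
  rcases N with _ | n
  · have hcong : vert (fun i j => (coeffs 0 i j).re) a = partialDer (Sum.inr (0, 0)) a := by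
      refine derivation_congr ?_
      rintro (l | ⟨l, m⟩) hlm
      · rw [vert_inl, partialDer_coord_of_ne (by simp)]
      · have := hlow l m hlm
        obtain rfl : l = 0 := by omega
        obtain rfl : m = 0 := by omega
        rw [vert_inr, partialDer_coord_self]
        simp [coeffs, components, componentsY]
    rw [(h 0).1] at hcong
    obtain rfl : i = 0 := by omega
    obtain rfl : j = 0 := by omega
    exact hne hcong.symm
  · set c : ℂ := coeffs (n + 1) 0 (n + 1) with hc
    have hc1 : coeffs (n + 1) 1 n = I * c := coeffs_one_top n
    have hc0 : c ≠ 0 := by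
      have := componentsY_top_ne_zero (n + 1)
      push_cast at this
      simpa [hc, coeffs, components] using this
    set W : EqFun := wE⁻¹ ^ (n + 1) with hW
    have hW0 : W ≠ 0 := pow_ne_zero _ (inv_ne_zero wE_ne_zero)
    have hgen : ∀ r : ℂ → ℝ, r 0 = 0 → vert (fun i j => r (coeffs (n + 1) i j)) a =
        (r c • W) * partialDer (Sum.inr (0, n + 1)) a +
        (r (I * c) • W) * partialDer (Sum.inr (1, n)) a := by
      intro r hr
      have : vert (fun i j => r (coeffs (n + 1) i j)) a =
          ((r c • W) • partialDer (Sum.inr (0, n + 1)) +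
            (r (I * c) • W) • partialDer (Sum.inr (1, n)) : Derivation ℝ EqFun EqFun) a := by
        refine derivation_congr ?_
        rintro (l | ⟨l, m⟩) hlm
        · rw [vert_inl, Derivation.add_apply, Derivation.smul_apply, Derivation.smul_apply,
            partialDer_coord_of_ne (by simp), partialDer_coord_of_ne (by simp)]
          simp
        · have hle := hlow l m hlm
          rw [vert_inr, Derivation.add_apply, Derivation.smul_apply, Derivation.smul_apply]
          by_cases hlt : l.val + m < n + 1
          · rw [coeffs_eq_zero l m (n + 1) (by rw [lt_abs]; omega), hr,
              partialDer_coord_of_ne, partialDer_coord_of_ne]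
            · simp
            · intro he
              simp only [Sum.inr.injEq, Prod.mk.injEq] at he
              rw [he.1, he.2] at hlt
              simp at hlt
            · intro he
              simp only [Sum.inr.injEq, Prod.mk.injEq] at he
              rw [he.1, he.2] at hlt
              simp at hlt
          · by_cases hl : l = 0
            · subst hl
              obtain rfl : m = n + 1 := by simp at hlt hle; omega
              rw [partialDer_coord_self, partialDer_coord_of_ne (by simp)]
              simp [hW, hc]
            · obtain rfl : l = 1 := by omega
              obtain rfl : m = n := by simp at hlt hle; omega
              rw [partialDer_coord_self, partialDer_coord_of_ne (by simp), hc1]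
              simp [hW, add_comm]
      rw [this]; rfl
    have h1 := hgen re rfl
    have h2 := hgen im rfl
    have hk := h (n + 1)
    rw [hk.1] at h1
    rw [hk.2] at h2
    set p := partialDer (Sum.inr (0, n + 1)) a with hp
    set q := partialDer (Sum.inr (1, n)) a with hq
    simp only [I_mul_re, I_mul_im, Algebra.smul_def, map_neg] at h1 h2
    have hnorm : algebraMap ℝ EqFun c.re * algebraMap ℝ EqFun c.re +
        algebraMap ℝ EqFun c.im * algebraMap ℝ EqFun c.im ≠ 0 := by
      rw [← map_mul, ← map_mul, ← map_add]
      exact (map_ne_zero _).2 (by rw [← normSq_apply]; exact (map_ne_zero normSq).2 hc0)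
    have hp0 : p = 0 := by
      have : W * (algebraMap ℝ EqFun c.re * algebraMap ℝ EqFun c.re +
        algebraMap ℝ EqFun c.im * algebraMap ℝ EqFun c.im) * p = 0 := by
        linear_combination -(algebraMap ℝ EqFun c.re) * h1 - (algebraMap ℝ EqFun c.im) * h2
      exact (mul_eq_zero.1 this).resolve_left (mul_ne_zero hW0 hnorm)
    have hq0 : q = 0 := by
      have : W * (algebraMap ℝ EqFun c.re * algebraMap ℝ EqFun c.re +
        algebraMap ℝ EqFun c.im * algebraMap ℝ EqFun c.im) * q = 0 := by
        linear_combination (algebraMap ℝ EqFun c.im) * h1 - (algebraMap ℝ EqFun c.re) * h2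
      exact (mul_eq_zero.1 this).resolve_left (mul_ne_zero hW0 hnorm)
    by_cases hi : i = 0
    · subst hi
      obtain rfl : j = n + 1 := by simp at hij hN; omega
      exact hne hp0
    · obtain rfl : i = 1 := by omega
      obtain rfl : j = n := by simp at hij hN; omega
      exact hne hq0

theorem cIncl_baseIncl_mem (a : RatFun (Fin 2)) : cIncl (baseIncl a) ∈ horizontal vertE := by
  rw [mem_horizontal]
  intro k
  rw [vertE, vertC_cIncl, derivation_baseIncl_eq_zero (vert_inl _),
    derivation_baseIncl_eq_zero (vert_inl _)]
  simp

theorem exists_of_mem_horizontal {f : CEqFun} (hf : f ∈ horizontal vertE) :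
    ∃ a b, f = cIncl (baseIncl a) + I • cIncl (baseIncl b) := by
  obtain ⟨a, b, rfl⟩ := exists_cIncl_add f
  rw [mem_horizontal] at hf
  have key : ∀ k, (vert (fun i j => (coeffs k i j).re) a = vert (fun i j => (coeffs k i j).im) b) ∧
      (vert (fun i j => (coeffs k i j).im) a = -vert (fun i j => (coeffs k i j).re) b) := by
    intro k
    have h : cIncl (vert (fun i j => (coeffs k i j).re) a - vert (fun i j => (coeffs k i j).im) b) +
        I • cIncl (vert (fun i j => (coeffs k i j).im) a +
          vert (fun i j => (coeffs k i j).re) b) = 0 := by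
      rw [← hf k, map_add (vertE k), map_smul (vertE k), vertE, vertC_cIncl, vertC_cIncl, map_sub,
        map_add]
      match_scalars
      · ring
      · linear_combination -I_sq
      · ring
      · ring
    obtain ⟨h1, h2⟩ := cIncl_add_eq_zero h
    exact ⟨sub_eq_zero.1 h1, eq_neg_of_add_eq_zero_left h2⟩
  have hre : ∀ k, (fun i j => (coeffs (-k) i j).re) = fun i j => (coeffs k i j).re := by
    intro k; funext i j; rw [coeffs_neg, conj_re]
  have him : ∀ k, (fun i j => (coeffs (-k) i j).im) = (-1 : ℝ) • fun i j => (coeffs k i j).im := by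
    intro k; funext i j; rw [coeffs_neg, conj_im]; simp
  have hneg : ∀ x : EqFun, x = -x → x = 0 := by
    intro x hx
    have := isFrame_eq.charZero
    exact self_eq_neg.1 hx
  have hab : ∀ k, (vert (fun i j => (coeffs k i j).re) a = 0 ∧
        vert (fun i j => (coeffs k i j).im) a = 0) ∧
      (vert (fun i j => (coeffs k i j).re) b = 0 ∧ vert (fun i j => (coeffs k i j).im) b = 0) := by
    intro k
    obtain ⟨h1, h2⟩ := key k
    obtain ⟨h3, h4⟩ := key (-k)
    rw [hre, him, vert_smul, Derivation.smul_apply, neg_one_smul] at h3 h4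
    have hb : vert (fun i j => (coeffs k i j).im) b = 0 := hneg _ (h1.symm.trans h3)
    have ha : vert (fun i j => (coeffs k i j).im) a = 0 := hneg _ (h2.trans h4.symm)
    rw [hb] at h1
    rw [ha] at h2
    exact ⟨⟨h1, ha⟩, ⟨by simpa using h2.symm, hb⟩⟩
  obtain ⟨a', ha'⟩ := exists_baseIncl_eq (partialDer_eq_zero_of_vert fun k => (hab k).1)
  obtain ⟨b', hb'⟩ := exists_baseIncl_eq (partialDer_eq_zero_of_vert fun k => (hab k).2)
  exact ⟨a', b', by rw [ha', hb']⟩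

theorem eq_smul_inv_pow {n : ℕ} {a : RatFun (Fin 2)}
    (hx : wE * DxE (baseIncl a) = -(n : EqFun) * baseIncl a)
    (hy : wE * DyE (baseIncl a) = -(n : EqFun) * baseIncl a) :
    ∃ c : ℝ, baseIncl a = c • wE⁻¹ ^ n := by
  set b : RatFun (Fin 2) := (coord 0 + coord 1) ^ n * a with hb
  have hbE : baseIncl b = wE ^ n * baseIncl a := by
    rw [hb, map_mul, map_pow, map_add, baseIncl_coord, baseIncl_coord, wE]
  have hD : ∀ D : Derivation ℝ EqFun EqFun, D wE = 1 →
      wE * D (baseIncl a) = -(n : EqFun) * baseIncl a → D (baseIncl b) = 0 := by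
    intro D hw hD
    refine (mul_eq_zero.1 (?_ : wE * D (baseIncl b) = 0)).resolve_left wE_ne_zero
    rw [hbE, Derivation.leibniz, Derivation.leibniz_pow, hw]
    simp only [smul_eq_mul, nsmul_eq_mul, mul_one]
    rcases n with _ | n
    · simp at hD ⊢; simp [hD]
    · simp only [Nat.add_sub_cancel]
      linear_combination wE ^ (n + 1) * hD
  have hinr : ∀ s, partialDer (Sum.inr s) (baseIncl b) = 0 := fun s =>
    derivation_baseIncl_eq_zero (fun i => partialDer_coord_of_ne (by simp)) b
  have hinl : ∀ (i : Fin 2) (D : Derivation ℝ EqFun EqFun), D (coord (Sum.inl i)) = 1 →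
      (∀ j ≠ i, D (coord (Sum.inl j)) = 0) → D (baseIncl b) = 0 →
      partialDer (Sum.inl i) (baseIncl b) = 0 := by
    intro i D hi hj h0
    rw [← h0]
    refine derivation_congr ?_
    rintro (j | s) hjs
    · by_cases hij : j = i
      · rw [hij, partialDer_coord_self, hi]
      · rw [partialDer_coord_of_ne (by simpa using hij), hj j hij]
    · exact absurd (hinr s) hjs
  obtain ⟨c, hc⟩ := eq_const_of_partialDer_eq_zero (f := baseIncl b) (by
    rintro (i | s)
    · fin_cases i
      · refine hinl 0 DxE isFrame_eq.d₁x ?_ (hD DxE DxE_wE hx)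
        intro j hj
        obtain rfl : j = 1 := by omega
        exact isFrame_eq.d₁y
      · refine hinl 1 DyE isFrame_eq.d₂y ?_ (hD DyE DyE_wE hy)
        intro j hj
        obtain rfl : j = 0 := by omega
        exact isFrame_eq.d₂x
    · exact hinr s)
  refine ⟨c, ?_⟩
  rw [Algebra.smul_def, ← hc, hbE, inv_pow, mul_comm (wE ^ n),
    mul_inv_cancel_right₀ (pow_ne_zero _ wE_ne_zero)]

end Completeness

section Horizontal

/-- The derivation `-∂/∂x + ∂/∂y` in the internal coordinates. -/
def horDer : Derivation ℝ EqFun EqFun := fracDer (Sum.elim ![-1, 1] fun _ => 0)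

theorem horDer_inr (s : Fin 2 × ℕ) : horDer (coord (Sum.inr s)) = 0 := by
  simp [horDer, fracDer_coord]

theorem horDer_x : horDer (coord (Sum.inl 0)) = -1 := by simp [horDer, fracDer_coord]

theorem horDer_y : horDer (coord (Sum.inl 1)) = 1 := by simp [horDer, fracDer_coord]

theorem horDer_wE : horDer wE = 0 := by rw [wE, map_add, horDer_x, horDer_y]; ring

theorem horDer_inv_pow (n : ℕ) : horDer (wE⁻¹ ^ n) = 0 := by
  rw [derivation_inv_pow, horDer_wE, mul_zero]

theorem vert_horDer (α : Fin 2 → ℕ → ℝ) (f : EqFun) : vert α (horDer f) = horDer (vert α f) := by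
  have h : ⁅vert α, horDer⁆ = 0 := by
    apply fracDer_ext
    rintro (i | ⟨i, j⟩)
    · fin_cases i <;> simp [Derivation.commutator_apply, vert_inl, horDer, fracDer_coord]
    · rw [Derivation.commutator_apply, vert_inr, horDer_inr, Derivation.map_smul, horDer_inv_pow]
      simp
  have := congrArg (fun D => D f) h
  simpa [Derivation.commutator_apply, sub_eq_zero] using this

theorem horDer_DyE (f : EqFun) : horDer (DyE f) = DyE (horDer f) := by
  have h : ⁅horDer, DyE⁆ = 0 := by
    apply fracDer_ext
    rintro (i | ⟨i, j⟩)
    · fin_cases i <;> simp [Derivation.commutator_apply, DyE, horDer, fracDer_coord]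
    · simp [Derivation.commutator_apply, horDer, DyE, fracDer_coord]
  have := congrArg (fun D => D f) h
  simpa [Derivation.commutator_apply, sub_eq_zero] using this

theorem horDer_uxxE (j : ℕ) : horDer (DyE^[j] uxxE) = 0 := by
  induction j with
  | zero =>
    have h : uxxE = -coord (Sum.inr (0, 2)) -
        (coord (Sum.inr (1, 0)) + coord (Sum.inr (0, 1))) * wE⁻¹ ^ 1 := by
      rw [uxxE, wE, pow_one, div_eq_mul_inv]
    rw [Function.iterate_zero, id_eq, h, map_sub, map_neg, Derivation.leibniz, horDer_inv_pow,
      map_add, horDer_inr, horDer_inr, horDer_inr]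
    simp
  | succ j ih => rw [Function.iterate_succ_apply', horDer_DyE, ih, map_zero]

theorem horDer_DxE (f : EqFun) : horDer (DxE f) = DxE (horDer f) := by
  have h : ⁅horDer, DxE⁆ = 0 := by
    apply fracDer_ext
    rintro (i | ⟨i, j⟩)
    · fin_cases i <;> simp [Derivation.commutator_apply, DxE, horDer, fracDer_coord]
    · rw [Derivation.commutator_apply, horDer_inr]
      fin_cases i
      · simp [DxE, fracDer_coord, horDer_inr]
      · simp [DxE, fracDer_coord, horDer_uxxE]
  have := congrArg (fun D => D f) h
  simpa [Derivation.commutator_apply, sub_eq_zero] using this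

/-- The restriction of the evolutionary field with generating function `-u_x + u_y`. -/
def evoBox : Derivation ℝ EqFun EqFun := -DxE + DyE - horDer

theorem evoBox_apply (f : EqFun) : evoBox f = boxOp DxE DyE f - horDer f := rfl

theorem evoBox_inl (i : Fin 2) : evoBox (coord (Sum.inl i)) = 0 := by
  rw [evoBox_apply, boxOp_apply]
  fin_cases i <;> simp [horDer, DxE, DyE, fracDer_coord]

theorem evoBox_DxE (f : EqFun) : evoBox (DxE f) = DxE (evoBox f) := by
  simp only [evoBox_apply, boxOp_apply, map_sub, map_add, map_neg, horDer_DxE, DxE_DyE]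

theorem evoBox_DyE (f : EqFun) : evoBox (DyE f) = DyE (evoBox f) := by
  simp only [evoBox_apply, boxOp_apply, map_sub, map_add, map_neg, horDer_DyE, DxE_DyE]

theorem commute_evoBox_iterComm (m j : ℕ) :
    Commute (evoBox : EqFun →ₗ[ℝ] EqFun) (nablaE m j : Module.End ℝ EqFun) := by
  have hb : Commute (evoBox : Module.End ℝ EqFun) (boxOp DxE DyE) := by
    refine LinearMap.ext fun f => ?_
    change evoBox (boxOp DxE DyE f) = boxOp DxE DyE (evoBox f)
    simp only [boxOp_apply, map_add, map_neg, evoBox_DxE, evoBox_DyE]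
  have ht : Commute (evoBox : Module.End ℝ EqFun)
      (tauOp (coord (Sum.inl 0)) (coord (Sum.inl 1)) DxE DyE) := by
    refine LinearMap.ext fun f => ?_
    change evoBox (tauOp _ _ DxE DyE f) = tauOp _ _ DxE DyE (evoBox f)
    obtain ⟨h1, h2, h3⟩ := isFrame_eq.derivation_tau_coeff evoBox
    simp only [tauOp_apply, map_add, Derivation.leibniz, evoBox_DxE, evoBox_DyE, h1, h2, h3,
      evoBox_inl, smul_eq_mul]
    ring
  induction j with
  | zero => exact hb.pow_right m
  | succ j ih =>
    change Commute _ (⁅nablaE m j, _⁆)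
    rw [Ring.lie_def]
    exact (ih.mul_right ht).sub_right (ht.mul_right ih)

theorem horDer_nablaE (m j : ℕ) :
    horDer (nablaE m (j + 1) uE) = -((((j : ℝ) + 1) * (2 * m - j)) • nablaE m j uE) := by
  have h1 := congrArg (fun T : Module.End ℝ EqFun => T uE) (isFrame_eq.isTriple.lie_e m j)
  have h2 := congrArg (fun T : Module.End ℝ EqFun => T uE) (commute_evoBox_iterComm m (j + 1))
  change evoBox (nablaE m (j + 1) uE) = nablaE m (j + 1) (evoBox uE) at h2
  have h3 : evoBox uE = boxOp DxE DyE uE := by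
    rw [evoBox_apply, uE, horDer_inr, sub_zero]
  rw [h3, evoBox_apply] at h2
  change (⁅nablaE m (j + 1), boxOp DxE DyE⁆ : Module.End ℝ EqFun) uE =
    (((j : ℝ) + 1) * (2 * m - j)) • nablaE m j uE at h1
  rw [Ring.lie_def, LinearMap.sub_apply, Module.End.mul_apply, Module.End.mul_apply, ← h2] at h1
  rw [← h1]; ring

theorem edOp_uE : edOp (coord (Sum.inl 0)) (coord (Sum.inl 1)) DxE DyE uE = 0 := by
  have hw := wE_ne_zero
  have h1 : DxE uE = coord (Sum.inr (1, 0)) := by simp [uE, DxE, fracDer_coord]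
  have h2 : DxE (coord (Sum.inr (1, 0))) = uxxE := by simp [DxE, fracDer_coord]
  have h3 : ∀ j, DyE (coord (Sum.inr (0, j))) = coord (Sum.inr (0, j + 1)) := by
    intro j; simp [DyE, fracDer_coord]
  rw [edOp_apply, h1, h2, uE, h3, h3, uxxE]
  change wE * (-_ - _ / wE + _) + _ + _ = _
  field_simp
  ring

theorem edOp_nablaE (m j : ℕ) :
    edOp (coord (Sum.inl 0)) (coord (Sum.inl 1)) DxE DyE (nablaE m j uE) = 0 :=
  isFrame_eq.edOp_iterComm edOp_uE m j

end Horizontal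

section Symbols

open Complex

/-- Multiplication by functions of `x` and `y` commutes with vertical derivations. -/
theorem vertC_cMul (α : Fin 2 → ℕ → ℂ) {a : EqFun} (ha : ∀ β, vert β a = 0) (f : CEqFun) :
    vertC α (cMul a f) = cMul a (vertC α f) := by
  have h : vertC α * cMul a = cMul a * vertC α := by
    apply cEqFun_end_ext
    intro f
    simp only [Module.End.mul_apply, cMul_cIncl, vertC_cIncl, map_add, map_smul,
      Derivation.leibniz, ha, smul_eq_mul, mul_zero, add_zero]
  exact congrArg (fun P => P f) h

theorem cMul_inv_cancel (f : CEqFun) : cMul wE⁻¹ (cMul wE f) = f := by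
  have h : cMul wE⁻¹ * cMul wE = 1 := by
    apply cEqFun_end_ext
    intro f
    rw [Module.End.mul_apply, cMul_cIncl, cMul_cIncl, inv_mul_cancel_left₀ wE_ne_zero]
    rfl
  exact congrArg (fun P => P f) h

theorem cMul_wE_injective : Function.Injective (cMul wE) :=
  Function.LeftInverse.injective cMul_inv_cancel

/-- The functions all of whose components of index greater than `r` vanish. -/
def orderLE (r : ℕ) : Submodule ℝ EqFun where
  carrier := {f | ∀ k : ℤ, (r : ℤ) < |k| → vertE k (cIncl f) = 0}
  zero_mem' := by intro k _; simp
  add_mem' := by intro f g hf hg k hk; rw [map_add, map_add, hf k hk, hg k hk, add_zero]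
  smul_mem' := by intro c f hf k hk; rw [cIncl_smul, map_smul, hf k hk, smul_zero]

theorem vert_base (β : Fin 2 → ℕ → ℝ) :
    vert β ((coord (Sum.inl 0)) ^ 2 / 2 - coord (Sum.inl 0) * coord (Sum.inl 1) -
      (coord (Sum.inl 1)) ^ 2 / 2) = 0 ∧
    vert β ((coord (Sum.inl 0)) ^ 2 / 2 + coord (Sum.inl 0) * coord (Sum.inl 1) -
      (coord (Sum.inl 1)) ^ 2 / 2) = 0 ∧
    vert β ((coord (Sum.inl 0) - coord (Sum.inl 1)) / 2) = 0 := by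
  obtain ⟨h1, h2, h3⟩ := isFrame_eq.derivation_tau_coeff (vert β)
  rw [h1, h2, h3]
  simp [vert_inl]

theorem orderLE_mul {r : ℕ} {a f : EqFun} (ha : ∀ β, vert β a = 0) (hf : f ∈ orderLE r) :
    a * f ∈ orderLE r := by
  intro k hk
  rw [← cMul_cIncl, vertE, vertC_cMul _ ha]
  change cMul a (vertE k (cIncl f)) = 0
  rw [hf k hk, map_zero]

theorem orderLE_mono {r r' : ℕ} (h : r ≤ r') : orderLE r ≤ orderLE r' :=
  fun _ hf k hk => hf k (by omega)

theorem orderLE_of_wE_mul {r : ℕ} {f : EqFun} (hf : wE * f ∈ orderLE r) : f ∈ orderLE r := by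
  intro k hk
  have := hf k hk
  rw [← cMul_cIncl, vertE, vertC_cMul _ vert_wE] at this
  exact cMul_wE_injective (this.trans (map_zero _).symm)

theorem orderLE_DxE {r : ℕ} {f : EqFun} (hf : f ∈ orderLE r) : DxE f ∈ orderLE (r + 1) := by
  refine orderLE_of_wE_mul fun k hk => ?_
  rw [lt_abs] at hk
  push_cast at hk
  rw [← opX_cIncl, vertE_opX, hf k (by rw [lt_abs]; omega), hf (k - 1) (by rw [lt_abs]; omega),
    hf (k + 1) (by rw [lt_abs]; omega)]
  simp

theorem orderLE_DyE {r : ℕ} {f : EqFun} (hf : f ∈ orderLE r) : DyE f ∈ orderLE (r + 1) := by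
  refine orderLE_of_wE_mul fun k hk => ?_
  rw [lt_abs] at hk
  push_cast at hk
  rw [← opY_cIncl, vertE_opY, hf k (by rw [lt_abs]; omega), hf (k - 1) (by rw [lt_abs]; omega),
    hf (k + 1) (by rw [lt_abs]; omega)]
  simp

theorem vertE_uE (k : ℤ) : vertE k (cIncl uE) = (if k = 0 then 1 else 0 : ℂ) • cIncl 1 := by
  rw [vertE, vertC_cIncl, uE, vert_inr, vert_inr]
  by_cases h : k = 0
  · subst h; simp [coeffs, components, componentsY]
  · simp [coeffs, components, componentsY, h]

theorem nablaE_mem_orderLE (m j : ℕ) : nablaE m j uE ∈ orderLE m := by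
  have h0 : uE ∈ orderLE 0 := by
    intro k hk
    have : k ≠ 0 := by rintro rfl; simp at hk
    rw [vertE_uE, if_neg this, zero_smul]
  have := apply_mem_of_mem_span_pow (F := orderLE) ?_ (isFrame_eq.isTriple.iterComm_mem m j) h0
  · rwa [zero_add] at this
  · intro r f hf
    have hx := orderLE_DxE hf
    have hy := orderLE_DyE hf
    have hf' := orderLE_mono (Nat.le_succ r) hf
    refine ⟨?_, ?_, ?_⟩
    · rw [boxOp_apply]; exact add_mem (neg_mem hx) hy
    · rw [sigmaOp_apply]
      exact add_mem (add_mem (orderLE_mul (fun β => vert_inl β 0) hx)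
        (orderLE_mul (fun β => vert_inl β 1) hy))
        (orderLE_mul (fun β => derivation_half (vert β)) hf')
    · rw [tauOp_apply]
      exact add_mem (add_mem (orderLE_mul (fun β => (vert_base β).1) hx)
        (orderLE_mul (fun β => (vert_base β).2.1) hy))
        (orderLE_mul (fun β => (vert_base β).2.2) hf')

/-- The complexification of `-D_x + D_y`. -/
def cBox : Module.End ℂ CEqFun := cOp (boxOp DxE DyE)

theorem cBox_cIncl (f : EqFun) : cBox (cIncl f) = cIncl (-DxE f + DyE f) := rfl

theorem omegaE_eq : omegaE = (-I) • (cMul wE * cBox) := by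
  apply cEqFun_end_ext
  intro f
  simp only [omegaE, LinearMap.smul_apply, LinearMap.sub_apply, Module.End.mul_apply, opX_cIncl,
    opY_cIncl, cBox_cIncl, cMul_cIncl, map_add,
    map_neg]
  module

theorem commute_cMul_cBox : Commute (cMul wE) cBox := by
  apply cEqFun_end_ext
  intro f
  simp only [Module.End.mul_apply, cMul_cIncl, cBox_cIncl, Derivation.leibniz, DxE_wE, DyE_wE,
    smul_eq_mul]
  congr 1
  ring

theorem commute_cBox_opX : Commute cBox opX := by
  apply cEqFun_end_ext
  intro f
  rw [Module.End.mul_apply, Module.End.mul_apply, opX_cIncl, cBox_cIncl, cBox_cIncl, opX_cIncl]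
  congr 1
  simp only [Derivation.leibniz, DxE_wE, DyE_wE, smul_eq_mul, map_add, map_neg, DxE_DyE]
  ring

theorem commute_cBox_opY : Commute cBox opY := by
  apply cEqFun_end_ext
  intro f
  rw [Module.End.mul_apply, Module.End.mul_apply, opY_cIncl, cBox_cIncl, cBox_cIncl, opY_cIncl]
  congr 1
  simp only [Derivation.leibniz, DxE_wE, DyE_wE, smul_eq_mul, map_add, map_neg, DxE_DyE]
  ring

end Symbols

section Classification

open Complex

/-- A multiple of the complexified Euler-Darboux operator, in terms of `thetaE` and `omegaE`. -/
def cEdOp : Module.End ℂ CEqFun := thetaE * thetaE + omegaE * thetaE + (1 / 2 : ℂ) • omegaE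

theorem cEdOp_apply (f : CEqFun) :
    cEdOp f = thetaE (thetaE f) + omegaE (thetaE f) + (1 / 2 : ℂ) • omegaE f := rfl

theorem cEdOp_cIncl (f : EqFun) : cEdOp (cIncl f) = (1 / 2 : ℂ) •
    cIncl (wE * edOp (coord (Sum.inl 0)) (coord (Sum.inl 1)) DxE DyE f) := by
  rw [cEdOp_apply, theta_eq_iff, opX_cIncl, opX_cIncl, opY_cIncl, opY_cIncl, ← map_add, edOp_apply,
    ← wE]
  congr 2
  simp only [Derivation.leibniz, DxE_wE, DyE_wE, smul_eq_mul]
  ring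

theorem cEdOp_nablaE (n j : ℕ) : cEdOp (cIncl (nablaE n j uE)) = 0 := by
  rw [cEdOp_cIncl, edOp_nablaE, mul_zero, map_zero, smul_zero]

theorem vertE_nablaE_eq_zero (n j : ℕ) {k : ℤ} (hk : (n : ℤ) < |k|) :
    vertE k (cIncl (nablaE n j uE)) = 0 := nablaE_mem_orderLE n j k hk

/-- The leading component of `nablaE n j uE`. -/
def leading (n j : ℕ) : CEqFun := vertE n (cIncl (nablaE n j uE))

/-- The horizontal functions which satisfy the equation of leading components of solutions. -/
def leadingSpace (n : ℕ) : Submodule ℂ CEqFun :=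
  horizontal vertE ⊓ LinearMap.ker (thetaE + omegaE + (n : ℂ) • (1 : Module.End ℂ CEqFun))

theorem mem_leadingSpace {n : ℕ} {f : CEqFun} : f ∈ leadingSpace n ↔
    f ∈ horizontal vertE ∧ thetaE f + omegaE f + (n : ℂ) • f = 0 := Iff.rfl

theorem vertE_mem_leadingSpace {n : ℕ} {f : CEqFun} (hf : cEdOp f = 0)
    (hn : ∀ k > (n : ℤ), vertE k f = 0) : vertE n f ∈ leadingSpace n :=
  mem_leadingSpace.2 ⟨isLadder.component_mem hf n, by
    simpa using (isLadder.chainEq hf).top_eq hn⟩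

theorem leading_mem (n j : ℕ) : leading n j ∈ leadingSpace n :=
  vertE_mem_leadingSpace (cEdOp_nablaE n j) fun k hk =>
    vertE_nablaE_eq_zero n j (by rw [lt_abs]; omega)

theorem vertE_cMul_wE (k : ℤ) (f : CEqFun) : vertE k (cMul wE f) = cMul wE (vertE k f) :=
  vertC_cMul _ vert_wE f

theorem cBox_mem_horizontal {f : CEqFun} (hf : f ∈ horizontal vertE) :
    cBox f ∈ horizontal vertE := by
  have h := isLadder.omega_mem hf
  rw [omegaE_eq, LinearMap.smul_apply, Submodule.smul_mem_iff _ (neg_ne_zero.2 I_ne_zero),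
    mem_horizontal] at h
  rw [mem_horizontal]
  intro k
  refine cMul_wE_injective ?_
  rw [← vertE_cMul_wE, map_zero]
  exact h k

theorem commute_cBox_thetaE : Commute cBox thetaE :=
  (commute_cBox_opX.smul_right _).add_right (commute_cBox_opY.smul_right _)

theorem commute_cBox_omegaE : Commute cBox omegaE :=
  (commute_cBox_opX.sub_right commute_cBox_opY).smul_right _

theorem cBox_mem_leadingSpace {n : ℕ} {f : CEqFun} (hf : f ∈ leadingSpace n) :
    cBox f ∈ leadingSpace n := by
  rw [mem_leadingSpace] at hf ⊢
  refine ⟨cBox_mem_horizontal hf.1, ?_⟩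
  have h1 : cBox (thetaE f) = thetaE (cBox f) := congrArg (fun P => P f) commute_cBox_thetaE.eq
  have h2 : cBox (omegaE f) = omegaE (cBox f) := congrArg (fun P => P f) commute_cBox_omegaE.eq
  rw [← h1, ← h2, ← map_smul, ← map_add, ← map_add, hf.2, map_zero]

theorem cBox_pow_eq_zero {d : ℕ} {f : CEqFun} (h : (omegaE ^ d) f = 0) : (cBox ^ d) f = 0 := by
  rw [omegaE_eq, smul_pow, commute_cMul_cBox.mul_pow, LinearMap.smul_apply] at h
  have h' := (smul_eq_zero.1 h).resolve_left (pow_ne_zero _ (neg_ne_zero.2 I_ne_zero))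
  rw [Module.End.mul_apply, Module.End.pow_apply] at h'
  exact cMul_wE_injective.iterate d (h'.trans (by rw [← Module.End.pow_apply, map_zero]))

theorem vertE_horDer (k : ℤ) (f : EqFun) :
    vertE k (cIncl (horDer f)) = cOp (horDer : EqFun →ₗ[ℝ] EqFun) (vertE k (cIncl f)) := by
  rw [vertE, vertC_cIncl, vertC_cIncl, vert_horDer, vert_horDer, map_add, map_smul, cOp_cIncl,
    cOp_cIncl]
  rfl

theorem cOp_horDer_of_mem {f : CEqFun} (hf : f ∈ horizontal vertE) :
    cOp (horDer : EqFun →ₗ[ℝ] EqFun) f = cBox f := by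
  have h : ∀ a, horDer (baseIncl a) = boxOp DxE DyE (baseIncl a) := by
    intro a
    have := derivation_baseIncl_eq_zero evoBox_inl a
    rw [evoBox_apply, sub_eq_zero] at this
    exact this.symm
  obtain ⟨a, b, rfl⟩ := exists_of_mem_horizontal hf
  rw [map_add, map_add, map_smul, map_smul, cBox, cOp_cIncl, cOp_cIncl, cOp_cIncl, cOp_cIncl, ← h,
    ← h]
  rfl

theorem cBox_leading_succ (n j : ℕ) :
    cBox (leading n (j + 1)) = (-(((j : ℂ) + 1) * (2 * n - j))) • leading n j := by
  rw [← cOp_horDer_of_mem (mem_leadingSpace.1 (leading_mem n (j + 1))).1, leading, ← vertE_horDer,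
    horDer_nablaE, ← neg_smul, cIncl_smul, map_smul, leading]
  push_cast
  rfl

theorem leading_zero (n : ℕ) : ∃ c : ℂ, c ≠ 0 ∧ leading n 0 = c • cIncl (wE⁻¹ ^ n) := by
  induction n with
  | zero =>
    refine ⟨1, one_ne_zero, ?_⟩
    have : leading 0 0 = vertE 0 (cIncl uE) := rfl
    rw [this, vertE_uE]
    simp
  | succ n ih =>
    obtain ⟨c, hc, h⟩ := ih
    refine ⟨-I * (n + 1 / 2) * c, ?_, ?_⟩
    · refine mul_ne_zero (mul_ne_zero (neg_ne_zero.2 I_ne_zero) ?_) hc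
      exact_mod_cast int_add_half_ne_zero n
    · have hE := isLadder.E_omega ((n + 1 : ℕ) : ℤ) (cIncl (nablaE n 0 uE))
      have hn : ((n + 1 : ℕ) : ℤ) - 1 = n := by push_cast; ring
      rw [vertE_nablaE_eq_zero n 0 (k := ((n + 1 : ℕ) : ℤ)) (by rw [lt_abs]; omega),
        vertE_nablaE_eq_zero n 0 (k := ((n + 1 : ℕ) : ℤ) + 1) (by rw [lt_abs]; omega), hn] at hE
      change _ = _ + _ - _ - _ • leading n 0 at hE
      have hs : cBox (cIncl (nablaE n 0 uE)) = cIncl (nablaE (n + 1) 0 uE) := by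
        change cIncl (boxOp DxE DyE ((boxOp DxE DyE ^ n) uE)) = cIncl ((boxOp DxE DyE ^ (n + 1)) uE)
        rw [pow_succ', Module.End.mul_apply]
      rw [omegaE_eq, LinearMap.smul_apply, Module.End.mul_apply, hs, map_smul, vertE_cMul_wE] at hE
      change -I • cMul wE (leading (n + 1) 0) = _ at hE
      have hw : cMul wE (cIncl (wE⁻¹ ^ (n + 1))) = cIncl (wE⁻¹ ^ n) := by
        rw [cMul_cIncl, pow_succ', mul_inv_cancel_left₀ wE_ne_zero]
      refine cMul_wE_injective ?_
      rw [map_smul, hw]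
      rw [h] at hE
      simp only [map_zero, smul_zero] at hE
      have h3 := congrArg (fun f => I • f) hE
      simp only [smul_smul, mul_neg, I_mul_I, neg_neg, one_smul] at h3
      rw [h3]
      push_cast
      module

theorem mem_span_of_cBox_eq_zero {n : ℕ} {f : CEqFun} (hf : f ∈ leadingSpace n)
    (hb : cBox f = 0) : f ∈ Submodule.span ℂ {leading n 0} := by
  rw [mem_leadingSpace] at hf
  obtain ⟨hf, h⟩ := hf
  have hω : omegaE f = 0 := by
    rw [omegaE_eq, LinearMap.smul_apply, Module.End.mul_apply, hb, map_zero, smul_zero]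
  have hXY : opX f = opY f := by
    have : I • (opX f - opY f) = 0 := hω
    exact sub_eq_zero.1 ((smul_eq_zero.1 this).resolve_left I_ne_zero)
  have hθ : thetaE f = opX f := by
    rw [thetaE, LinearMap.add_apply, LinearMap.smul_apply, LinearMap.smul_apply, ← hXY]
    module
  rw [hω, hθ, add_zero] at h
  have hY := h
  rw [hXY] at hY
  obtain ⟨a, b, rfl⟩ := exists_of_mem_horizontal hf
  have hx : ∀ (D : Derivation ℝ EqFun EqFun) (P : Module.End ℂ CEqFun),
      (∀ f, P (cIncl f) = cIncl (wE * D f)) →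
      P (cIncl (baseIncl a) + I • cIncl (baseIncl b)) +
        (n : ℂ) • (cIncl (baseIncl a) + I • cIncl (baseIncl b)) = 0 →
      wE * D (baseIncl a) = -(n : EqFun) * baseIncl a ∧
      wE * D (baseIncl b) = -(n : EqFun) * baseIncl b := by
    intro D P hP h0
    have hn : ∀ g, cIncl (wE * D g + (n : ℝ) • g) = P (cIncl g) + (n : ℂ) • cIncl g := by
      intro g; rw [map_add, cIncl_smul, hP]; simp
    have := cIncl_add_eq_zero (a := wE * D (baseIncl a) + (n : ℝ) • baseIncl a)
      (b := wE * D (baseIncl b) + (n : ℝ) • baseIncl b) (by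
        rw [hn, hn, ← h0, map_add, map_smul]
        module)
    simp only [Algebra.smul_def (R := ℝ), map_natCast] at this
    exact ⟨by linear_combination this.1, by linear_combination this.2⟩
  obtain ⟨hax, hbx⟩ := hx DxE opX opX_cIncl h
  obtain ⟨hay, hby⟩ := hx DyE opY opY_cIncl hY
  obtain ⟨c₁, h₁⟩ := eq_smul_inv_pow hax hay
  obtain ⟨c₂, h₂⟩ := eq_smul_inv_pow hbx hby
  obtain ⟨c, hc, h0⟩ := leading_zero n
  rw [Submodule.mem_span_singleton]
  refine ⟨(c₁ + I * c₂) / c, ?_⟩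
  rw [h0, h₁, h₂, smul_smul, div_mul_cancel₀ _ hc, cIncl_smul, cIncl_smul]
  module

theorem mem_span_leading {n d : ℕ} (hd : d ≤ 2 * n + 1) {f : CEqFun} (hf : f ∈ leadingSpace n)
    (hb : (cBox ^ d) f = 0) : f ∈ Submodule.span ℂ (leading n '' Set.Iio d) := by
  induction d generalizing f with
  | zero =>
    rw [pow_zero, Module.End.one_apply] at hb
    rw [hb]; exact zero_mem _
  | succ d ih =>
    rw [pow_succ, Module.End.mul_apply] at hb
    have h1 := ih (by omega) (cBox_mem_leadingSpace hf) hb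
    have h2 : Submodule.span ℂ (leading n '' Set.Iio d) ≤
        (Submodule.span ℂ (leading n '' Set.Iio (d + 1))).map cBox := by
      rw [Submodule.span_le]
      rintro _ ⟨j, hj, rfl⟩
      rw [Set.mem_Iio] at hj
      have hne : -(((j : ℂ) + 1) * (2 * n - j)) ≠ 0 := by
        refine neg_ne_zero.2 (mul_ne_zero (by exact_mod_cast j.succ_ne_zero) (sub_ne_zero.2 ?_))
        norm_cast
        omega
      rw [SetLike.mem_coe, ← Submodule.smul_mem_iff _ hne, ← cBox_leading_succ]
      exact Submodule.mem_map_of_mem (Submodule.subset_span ⟨j + 1, by simpa using hj, rfl⟩)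
    obtain ⟨g, hg, hgf⟩ := h2 h1
    have hgl : g ∈ leadingSpace n :=
      Submodule.span_le.2 (by rintro _ ⟨j, -, rfl⟩; exact leading_mem n j) hg
    have h3 := mem_span_of_cBox_eq_zero (sub_mem hf hgl) (by rw [map_sub, hgf, sub_self])
    have h4 := Submodule.span_mono (t := leading n '' Set.Iio (d + 1))
      (Set.singleton_subset_iff.2 ⟨0, by simp, rfl⟩) h3
    simpa using add_mem h4 hg

theorem mem_span_sup_horizontal {n : ℕ} {f : CEqFun} (hf : cEdOp f = 0)
    (hn : ∀ k : ℤ, (n : ℤ) ≤ |k| → vertE k f = 0) :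
    f ∈ Submodule.span ℂ (Set.range fun i : ℕ × ℕ => cIncl (nablaE i.1 i.2 uE)) ⊔
      horizontal vertE := by
  induction n generalizing f with
  | zero =>
    refine Submodule.mem_sup_right (mem_horizontal.2 fun k => hn k ?_)
    simp
  | succ n ih =>
    have hn1 : ∀ k > (n : ℤ), vertE k f = 0 := fun k hk => hn k (by rw [le_abs]; push_cast; omega)
    have hn2 : ∀ k < -(n : ℤ), vertE k f = 0 := fun k hk => hn k (by rw [le_abs]; push_cast; omega)
    have hω := (isLadder.chainEq hf).omega_pow_eq_zero isLadder.theta_omega hn2 hn1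
    have h1 := mem_span_leading le_rfl (vertE_mem_leadingSpace hf hn1) (cBox_pow_eq_zero hω)
    have h2 : Submodule.span ℂ (leading n '' Set.Iio (2 * n + 1)) ≤
        (Submodule.span ℂ (Set.range fun j => cIncl (nablaE n j uE))).map (vertE n) := by
      rw [Submodule.span_le]
      rintro _ ⟨j, -, rfl⟩
      exact Submodule.mem_map_of_mem (Submodule.subset_span ⟨j, rfl⟩)
    obtain ⟨g, hg, hgf⟩ := h2 h1
    have hg0 : cEdOp g = 0 := by
      have : Submodule.span ℂ (Set.range fun j => cIncl (nablaE n j uE)) ≤ LinearMap.ker cEdOp :=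
        Submodule.span_le.2 (by rintro _ ⟨j, rfl⟩; exact cEdOp_nablaE n j)
      exact this hg
    have hgk : ∀ k : ℤ, (n : ℤ) < |k| → vertE k g = 0 := by
      intro k hk
      have : Submodule.span ℂ (Set.range fun j => cIncl (nablaE n j uE)) ≤
          LinearMap.ker (vertE k) :=
        Submodule.span_le.2 (by rintro _ ⟨j, rfl⟩; exact vertE_nablaE_eq_zero n j hk)
      exact this hg
    have hd0 : cEdOp (f - g) = 0 := by rw [map_sub, hf, hg0, sub_zero]
    have hd1 : ∀ k : ℤ, (n : ℤ) < |k| → vertE k (f - g) = 0 := by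
      intro k hk
      rw [map_sub, hn k (by push_cast; omega), hgk k hk, sub_zero]
    have hd2 : vertE n (f - g) = 0 := by rw [map_sub, hgf, sub_self]
    have hd3 : vertE (-n) (f - g) = 0 := by
      refine (isLadder.chainEq hd0).bottom_eq_zero isLadder.theta_omega (m := (n : ℤ) - 1)
        (by omega) (fun k hk => hd1 k (by rw [lt_abs]; omega)) fun k hk => ?_
      rcases (show (n : ℤ) ≤ k by omega).eq_or_lt with h | h
      · rw [← h]; exact hd2
      · exact hd1 k (by rw [lt_abs]; omega)
    have hd4 := ih hd0 (by
      intro k hk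
      rcases hk.lt_or_eq with h | h
      · exact hd1 k h
      · rcases (abs_eq (by omega)).1 h.symm with h | h
        · rw [h]; exact hd2
        · rw [h]; exact hd3)
    have hg' : g ∈ Submodule.span ℂ (Set.range fun i : ℕ × ℕ => cIncl (nablaE i.1 i.2 uE)) :=
      Submodule.span_mono (by rintro _ ⟨j, rfl⟩; exact ⟨(n, j), rfl⟩) hg
    simpa using add_mem hd4 (Submodule.mem_sup_left hg')

/-- A solution of the linearized equation is a combination of the `nablaE m j uE`, up to a function
of `x` and `y`. -/
theorem exists_add_baseIncl {g : EqFun}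
    (hg : edOp (coord (Sum.inl 0)) (coord (Sum.inl 1)) DxE DyE g = 0) :
    ∃ f ∈ Submodule.span ℝ (Set.range fun i : ℕ × ℕ => nablaE i.1 i.2 uE), ∃ s,
      g = f + baseIncl s := by
  have h0 : cEdOp (cIncl g) = 0 := by rw [cEdOp_cIncl, hg, mul_zero, map_zero, smul_zero]
  obtain ⟨N, hN⟩ := isLadder.finite (cIncl g)
  obtain ⟨f, hf, b, hb, hfb⟩ := Submodule.mem_sup.1 (mem_span_sup_horizontal (n := N + 1) h0
    fun k hk => hN k (by push_cast at hk; omega))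
  obtain ⟨s, t, rfl⟩ := exists_of_mem_horizontal hb
  refine ⟨cRe f, ?_, s, ?_⟩
  · suffices ∀ c : ℂ, cRe (c • f) ∈
        Submodule.span ℝ (Set.range fun i : ℕ × ℕ => nablaE i.1 i.2 uE) by
      simpa using this 1
    clear hfb
    induction hf using Submodule.span_induction with
    | mem f hf =>
      obtain ⟨i, rfl⟩ := hf
      intro c
      rw [cRe_smul_cIncl]
      exact Submodule.smul_mem _ _ (Submodule.subset_span ⟨i, rfl⟩)
    | zero => intro c; simp
    | add f₁ f₂ _ _ h₁ h₂ => intro c; rw [smul_add, map_add]; exact add_mem (h₁ c) (h₂ c)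
    | smul a f _ h => intro c; rw [smul_smul]; exact h _
  · have := congrArg cRe hfb
    rw [map_add, map_add, cRe_cIncl, cRe_cIncl, cRe_smul_cIncl] at this
    simpa using this.symm

theorem leading_ne_zero {n j : ℕ} (hj : j ≤ 2 * n) : leading n j ≠ 0 := by
  induction j with
  | zero =>
    obtain ⟨c, hc, h⟩ := leading_zero n
    rw [h]
    refine smul_ne_zero hc fun h0 => ?_
    have := congrArg cRe h0
    rw [cRe_cIncl, map_zero] at this
    exact pow_ne_zero _ (inv_ne_zero wE_ne_zero) this
  | succ j ih =>
    intro h0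
    have h := cBox_leading_succ n j
    rw [h0, map_zero] at h
    refine smul_ne_zero (neg_ne_zero.2 (mul_ne_zero (by exact_mod_cast j.succ_ne_zero)
      (sub_ne_zero.2 ?_))) (ih (by omega)) h.symm
    norm_cast
    omega

theorem nablaE_ne_baseIncl {n j : ℕ} (hj : j ≤ 2 * n) (s : RatFun (Fin 2)) :
    nablaE n j uE ≠ baseIncl s := by
  intro h
  refine leading_ne_zero hj ?_
  rw [leading, h]
  exact mem_horizontal.1 (cIncl_baseIncl_mem s) n

end Classification

section Symmetries

theorem Dx_Dy (f : JetFun) : Dx (Dy f) = Dy (Dx f) := by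
  have h : ⁅Dx, Dy⁆ = 0 := by
    apply fracDer_ext
    rintro (i | s)
    · fin_cases i <;> simp [Derivation.commutator_apply, Dx, Dy, fracDer_coord]
    · simp [Derivation.commutator_apply, Dx, Dy, fracDer_coord]
  have := congrArg (fun D => D f) h
  simpa [Derivation.commutator_apply, sub_eq_zero] using this

theorem isFrame_jet : IsFrame (coord (Sum.inl 0) : JetFun) (coord (Sum.inl 1)) Dx Dy where
  d₁x := by simp [Dx, fracDer_coord]
  d₁y := by simp [Dx, fracDer_coord]
  d₂x := by simp [Dy, fracDer_coord]
  d₂y := by simp [Dy, fracDer_coord]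
  comm := Dx_Dy

theorem evolutionary_inl (φ : JetFun) (i : Fin 2) : evolutionary φ (coord (Sum.inl i)) = 0 := by
  simp [evolutionary, fracDer_coord]

theorem evolutionary_inr (φ : JetFun) (s : ℕ × ℕ) :
    evolutionary φ (coord (Sum.inr s)) = Dx^[s.1] (Dy^[s.2] φ) := by
  simp [evolutionary, fracDer_coord]

theorem Dy_iterate_Dx (n : ℕ) (f : JetFun) : Dy (Dx^[n] f) = Dx^[n] (Dy f) := by
  induction n with
  | zero => rfl
  | succ n ih => rw [Function.iterate_succ_apply', ← Dx_Dy, ih, Function.iterate_succ_apply']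

theorem evolutionary_Dx (φ f : JetFun) : evolutionary φ (Dx f) = Dx (evolutionary φ f) := by
  have h : ⁅evolutionary φ, Dx⁆ = 0 := by
    apply fracDer_ext
    rintro (i | s)
    · rw [Derivation.commutator_apply, evolutionary_inl]
      fin_cases i <;> simp [Dx, fracDer_coord]
    · have : Dx (coord (Sum.inr s)) = coord (Sum.inr (s.1 + 1, s.2)) := by simp [Dx, fracDer_coord]
      rw [Derivation.commutator_apply, this, evolutionary_inr, evolutionary_inr,
        Function.iterate_succ_apply', sub_self]
      rfl
  have := congrArg (fun D => D f) h
  simpa [Derivation.commutator_apply, sub_eq_zero] using this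

theorem evolutionary_Dy (φ f : JetFun) : evolutionary φ (Dy f) = Dy (evolutionary φ f) := by
  have h : ⁅evolutionary φ, Dy⁆ = 0 := by
    apply fracDer_ext
    rintro (i | s)
    · rw [Derivation.commutator_apply, evolutionary_inl]
      fin_cases i <;> simp [Dy, fracDer_coord]
    · have : Dy (coord (Sum.inr s)) = coord (Sum.inr (s.1, s.2 + 1)) := by simp [Dy, fracDer_coord]
      rw [Derivation.commutator_apply, this, evolutionary_inr, evolutionary_inr,
        Function.iterate_succ_apply', Dy_iterate_Dx, sub_self]
      rfl
  have := congrArg (fun D => D f) h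
  simpa [Derivation.commutator_apply, sub_eq_zero] using this

theorem evolutionary_iterate (φ f : JetFun) (a b : ℕ) :
    evolutionary φ (Dx^[a] (Dy^[b] f)) = Dx^[a] (Dy^[b] (evolutionary φ f)) := by
  have hx : Function.Semiconj (evolutionary φ) Dx Dx := evolutionary_Dx φ
  have hy : Function.Semiconj (evolutionary φ) Dy Dy := evolutionary_Dy φ
  rw [(hx.iterate_right a).eq, (hy.iterate_right b).eq]

theorem evolutionary_edPoly (φ : JetFun) : evolutionary φ (algebraMap _ JetFun edPoly) =
    edOp (coord (Sum.inl 0)) (coord (Sum.inl 1)) Dx Dy φ := by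
  have h : algebraMap _ JetFun edPoly = (coord (Sum.inl 0) + coord (Sum.inl 1)) *
      (coord (Sum.inr (2, 0)) + coord (Sum.inr (0, 2))) + coord (Sum.inr (1, 0)) +
      coord (Sum.inr (0, 1)) := by
    simp only [edPoly, coord, map_add, map_mul]
  rw [h, edOp_apply]
  simp only [map_add, Derivation.leibniz, evolutionary_inl, evolutionary_inr, smul_eq_mul,
    add_zero, mul_zero, Function.iterate_succ, Function.iterate_zero, Function.comp_apply, id_eq]

theorem RestrictsTo.unique {f : JetFun} {g₁ g₂ : EqFun} (h₁ : RestrictsTo f g₁)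
    (h₂ : RestrictsTo f g₂) : g₁ = g₂ := by
  obtain ⟨p₁, q₁, hq₁, hf₁, rfl⟩ := h₁
  obtain ⟨p₂, q₂, hq₂, hf₂, rfl⟩ := h₂
  rw [hf₁, div_eq_div_iff (ne_zero_of_restrictPoly hq₁) (ne_zero_of_restrictPoly hq₂), ← map_mul,
    ← map_mul] at hf₂
  have := congrArg restrictPoly (IsFractionRing.injective (MvPolynomial JetVar ℝ) JetFun hf₂)
  rw [map_mul, map_mul] at this
  rwa [div_eq_div_iff hq₁ hq₂]

theorem opRestrictsTo_edOp :
    OpRestrictsTo (edOp (coord (Sum.inl 0)) (coord (Sum.inl 1)) Dx Dy)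
      (edOp (coord (Sum.inl 0)) (coord (Sum.inl 1)) DxE DyE) := by
  intro f g h
  have hx : RestrictsTo (coord (Sum.inl 0)) (coord (Sum.inl 0)) := restrictsTo_coord (Sum.inl 0)
  have hy : RestrictsTo (coord (Sum.inl 1)) (coord (Sum.inl 1)) := restrictsTo_coord (Sum.inl 1)
  have h1 := opRestrictsTo_Dx _ _ h
  have h2 := opRestrictsTo_Dy _ _ h
  rw [edOp_apply, edOp_apply]
  exact (((hx.add hy).mul ((opRestrictsTo_Dx _ _ h1).add (opRestrictsTo_Dy _ _ h2))).add h1).add h2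

theorem OpRestrictsTo.iterate_zero {D : Derivation ℝ JetFun JetFun} {E : Derivation ℝ EqFun EqFun}
    (h : OpRestrictsTo D E) {f : JetFun} (hf : RestrictsTo f 0) (n : ℕ) :
    RestrictsTo (D^[n] f) 0 := by
  induction n with
  | zero => exact hf
  | succ n ih => rw [Function.iterate_succ_apply', ← map_zero E]; exact h _ _ ih

theorem mem_HigherSym_iff {g : EqFun} : g ∈ HigherSym ↔ (∃ φ, RestrictsTo φ g) ∧
    edOp (coord (Sum.inl 0)) (coord (Sum.inl 1)) DxE DyE g = 0 := by
  constructor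
  · rintro ⟨φ, hφ, ht⟩
    refine ⟨⟨φ, hφ⟩, (opRestrictsTo_edOp φ g hφ).unique ?_⟩
    have := ht 0 0
    rwa [Function.iterate_zero, id_eq, Function.iterate_zero, id_eq, evolutionary_edPoly] at this
  · rintro ⟨⟨φ, hφ⟩, hg⟩
    refine ⟨φ, hφ, fun a b => ?_⟩
    rw [evolutionary_iterate, evolutionary_edPoly]
    refine opRestrictsTo_Dx.iterate_zero (opRestrictsTo_Dy.iterate_zero ?_ b) a
    rw [← hg]
    exact opRestrictsTo_edOp φ g hφ

theorem nablaE_mem_HigherSym (m j : ℕ) : nablaE m j uE ∈ HigherSym :=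
  mem_HigherSym_iff.2 ⟨⟨_, nabla_restrictsTo m j _ _ (restrictsTo_coord (Sum.inr (0, 0)))⟩,
    edOp_nablaE m j⟩

theorem baseIncl_mem_Sol {s : RatFun (Fin 2)}
    (hs : edOp (coord (Sum.inl 0)) (coord (Sum.inl 1)) DxE DyE (baseIncl s) = 0) :
    baseIncl s ∈ Sol := by
  refine ⟨s, ?_, rfl⟩
  have hx : ∀ g, DxE (baseIncl g) = baseIncl (pdx g) := derivation_baseIncl (by
    intro i; fin_cases i <;> simp [DxE, pdx, fracDer_coord])
  have hy : ∀ g, DyE (baseIncl g) = baseIncl (pdy g) := derivation_baseIncl (by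
    intro i; fin_cases i <;> simp [DyE, pdy, fracDer_coord])
  rw [edOp_apply, hx, hx, hy, hy, ← baseIncl_coord, ← baseIncl_coord] at hs
  simp only [← map_add, ← map_mul] at hs
  change evalOnJet s edPoly = 0
  refine (map_eq_zero baseIncl).1 ?_
  rw [← hs]
  simp only [evalOnJet, edPoly, map_add, map_mul, aeval_X, Sum.elim_inl, Sum.elim_inr,
    Function.iterate_succ, Function.iterate_zero, Function.comp_apply, id_eq]

theorem NSym_eq_span : NSym = Submodule.span ℝ
    ({Sol.mkQ uE} ∪ Set.range fun i : ℕ × ℕ => Sol.mkQ (nablaE i.1 i.2 uE)) := by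
  apply le_antisymm
  · rintro _ ⟨g, hg, rfl⟩
    have hg0 := (mem_HigherSym_iff.1 hg).2
    obtain ⟨f, hf, s, rfl⟩ := exists_add_baseIncl hg0
    have hspan : Submodule.span ℝ (Set.range fun i : ℕ × ℕ => nablaE i.1 i.2 uE) ≤
        LinearMap.ker (edOp (coord (Sum.inl 0)) (coord (Sum.inl 1)) DxE DyE) :=
      Submodule.span_le.2 (by rintro _ ⟨i, rfl⟩; exact edOp_nablaE i.1 i.2)
    rw [map_add, LinearMap.mem_ker.1 (hspan hf), zero_add] at hg0
    have hs : Sol.mkQ (baseIncl s) = 0 :=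
      (Submodule.Quotient.mk_eq_zero Sol).2 (baseIncl_mem_Sol hg0)
    rw [map_add, hs, add_zero]
    refine Submodule.span_mono (Set.subset_union_right) ?_
    rw [Set.range_comp' Sol.mkQ fun i : ℕ × ℕ => nablaE i.1 i.2 uE, Submodule.span_image]
    exact Submodule.mem_map_of_mem hf
  · rw [Submodule.span_le]
    rintro _ (h | ⟨i, rfl⟩)
    · rw [Set.mem_singleton_iff.1 h]
      exact Submodule.mem_map_of_mem (nablaE_mem_HigherSym 0 0)
    · exact Submodule.mem_map_of_mem (nablaE_mem_HigherSym i.1 i.2)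

end Symmetries

end EulerDarboux

end

open EulerDarboux
theorem mainTheorem3 :
    NSym = Submodule.span ℝ
        ({Sol.mkQ uE} ∪ Set.range fun i : ℕ × ℕ => Sol.mkQ (nablaE i.1 i.2 uE)) ∧
      (∀ m j : ℕ, 1 ≤ j → j ≤ 2 * m →
        ⁅nabla m j, box⁆ = ((j : ℝ) * (2 * (m : ℝ) - (j : ℝ) + 1)) • nabla m (j - 1)) ∧
      (∀ m j : ℕ, j ≤ 2 * m → ⁅nabla m j, sigma⁆ = ((m : ℝ) - (j : ℝ)) • nabla m j) ∧
      (∀ m j : ℕ, j ≤ 2 * m → ⁅nabla m j, tau⁆ = nabla m (j + 1)) ∧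
      (∀ m j : ℕ, j ≤ 2 * m → nablaE m j uE ≠ 0 ∧ Sol.mkQ (nablaE m j uE) ≠ 0) ∧
      (∀ m j : ℕ, 2 * m + 1 ≤ j → nablaE m j uE = 0) := by
  refine ⟨NSym_eq_span, ?_, fun m j _ => isFrame_jet.isTriple.lie_s m j, fun m j _ => rfl, ?_, ?_⟩
  · intro m j hj _
    obtain ⟨j, rfl⟩ : ∃ i, j = i + 1 := ⟨j - 1, by omega⟩
    rw [Nat.add_sub_cancel]
    refine (isFrame_jet.isTriple.lie_e m j).trans ?_
    congr 1
    push_cast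
    ring
  · intro m j hj
    refine ⟨fun h => nablaE_ne_baseIncl hj 0 (by rw [h, map_zero]), fun h => ?_⟩
    obtain ⟨s, -, hs⟩ := (Submodule.Quotient.mk_eq_zero Sol).1 h
    exact nablaE_ne_baseIncl hj s hs.symm
  · intro m j hj
    have h := isFrame_eq.isTriple.iterComm_eq_zero m j hj
    exact congrArg (fun T : Module.End ℝ EqFun => T uE) h
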